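/- Let $\mathcal O=\mathbf C\{x,y\}$ be the ring of convergent power series in two variables and let $\mathcal D$ be the ring of linear differential operators with coefficients in $\mathcal O$. Let $f\in\mathcal O$ be reduced (non-zero, without multiple factors) with $f(0,0)=0$. Let $\mathrm{Der}(\log f)$ be the $\mathcal O$-module of all $\mathbf C$-derivations $\delta$ of $\mathcal O$ such that $\delta(f)=af$ for some $a\in\mathcal O$. Let $\widetilde I^{\log}$ be the left ideal of $\mathcal D$ generated by all operators $\delta+a$, where $\delta$ is a $\mathbf C$-derivation of $\mathcal O$, $a\in\mathcal O$ and $\delta(f)=af$, and put $\widetilde M^{\log}=\mathcal D/\widetilde I^{\log}$. Let $\{\delta_1,\delta_2\}$ be a basis of the $\mathcal O$-module $\mathrm{Der}(\log f)$, and let $a_1,a_2,\alpha_1,\alpha_2\in\mathcal O$ be such that $\delta_i(f)=a_if$ for $i=1,2$ and $[\delta_1,\delta_2]=\alpha_1\delta_1+\alpha_2\delta_2$. Then $$0\longrightarrow\mathcal D\stackrel{\phi_2}{\longrightarrow}\mathcal D^2\stackrel{\phi_1}{\longrightarrow}\mathcal D\stackrel{\pi}{\longrightarrow}\widetilde M^{\log}\longrightarrow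 0$$ is an exact sequence of left $\mathcal D$-modules, hence a free resolution of $\widetilde M^{\log}$, where $$\phi_2(P)=\bigl(P\,(-\delta_2-a_2-\alpha_1),\ P\,(\delta_1+a_1-\alpha_2)\bigr),\qquad \phi_1(P,Q)=P\,(\delta_1+a_1)+Q\,(\delta_2+a_2),$$ and $\pi$ is the canonical projection. -/

import Mathlib

/-- A formal power series in two variables over `ℂ` is convergent if it converges absolutely on
some polydisc of positive radius around the origin. -/
def IsConvergentSeries (f : MvPowerSeries (Fin 2) ℂ) : Prop :=
  ∃ r : ℝ, 0 < r ∧ Summable fun n : Fin 2 →₀ ℕ => ‖MvPowerSeries.coeff n f‖ * r ^ n.degree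

theorem IsConvergentSeries.of_summable_le {f : MvPowerSeries (Fin 2) ℂ} {r s : ℝ} (hs : 0 ≤ s)
    (hsr : s ≤ r)
    (h : Summable fun n : Fin 2 →₀ ℕ => ‖MvPowerSeries.coeff n f‖ * r ^ n.degree) :
    Summable fun n : Fin 2 →₀ ℕ => ‖MvPowerSeries.coeff n f‖ * s ^ n.degree :=
  Summable.of_nonneg_of_le (fun n => by positivity) (fun n => by gcongr) h

theorem IsConvergentSeries.add {f g : MvPowerSeries (Fin 2) ℂ} (hf : IsConvergentSeries f)
    (hg : IsConvergentSeries g) : IsConvergentSeries (f + g) := by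
  obtain ⟨r, hr, hf⟩ := hf
  obtain ⟨s, hs, hg⟩ := hg
  have ht : 0 < min r s := lt_min hr hs
  refine ⟨min r s, ht, Summable.of_nonneg_of_le (fun n => by positivity) (fun n => ?_)
    ((of_summable_le ht.le (min_le_left r s) hf).add
      (of_summable_le ht.le (min_le_right r s) hg))⟩
  rw [map_add, ← add_mul]
  gcongr
  exact norm_add_le _ _

theorem IsConvergentSeries.summable_antidiagonal {u v : (Fin 2 →₀ ℕ) → ℝ} (hu : Summable u)
    (hv : Summable v) (hu0 : ∀ n, 0 ≤ u n) (hv0 : ∀ n, 0 ≤ v n) :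
    Summable fun n : Fin 2 →₀ ℕ =>
      ∑ p ∈ Finset.HasAntidiagonal.antidiagonal n, u p.1 * v p.2 :=
  summable_sum_mul_antidiagonal_of_summable_mul (f := u) (g := v) (hu.mul_of_nonneg hv hu0 hv0)

theorem IsConvergentSeries.mul {f g : MvPowerSeries (Fin 2) ℂ} (hf : IsConvergentSeries f)
    (hg : IsConvergentSeries g) : IsConvergentSeries (f * g) := by
  obtain ⟨r, hr, hf⟩ := hf
  obtain ⟨s, hs, hg⟩ := hg
  have ht : 0 < min r s := lt_min hr hs
  have hf' := of_summable_le ht.le (min_le_left r s) hf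
  have hg' := of_summable_le ht.le (min_le_right r s) hg
  have hsum := summable_antidiagonal hf' hg' (fun n => by positivity) (fun n => by positivity)
  refine ⟨min r s, ht, Summable.of_nonneg_of_le (fun n => by positivity) (fun n => ?_) hsum⟩
  rw [MvPowerSeries.coeff_mul]
  refine (mul_le_mul_of_nonneg_right (norm_sum_le _ _) (by positivity)).trans (le_of_eq ?_)
  rw [Finset.sum_mul]
  refine Finset.sum_congr rfl fun p hp => ?_
  have hn : n.degree = p.1.degree + p.2.degree := by
    rw [← Finset.HasAntidiagonal.mem_antidiagonal.1 hp, map_add]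
  rw [hn, pow_add, norm_mul]
  ring

theorem IsConvergentSeries.algebraMap (c : ℂ) :
    IsConvergentSeries (algebraMap ℂ (MvPowerSeries (Fin 2) ℂ) c) := by
  classical
  refine ⟨1, one_pos, summable_of_ne_finset_zero (s := {0}) fun n hn => ?_⟩
  have hn' : n ≠ 0 := by simpa using hn
  rw [MvPowerSeries.algebraMap_apply, MvPowerSeries.coeff_C]
  simp [hn']

/-- The ring `ℂ{x, y}` of convergent power series, as a subalgebra of `ℂ⟦x, y⟧`. -/
noncomputable def convergentSeries : Subalgebra ℂ (MvPowerSeries (Fin 2) ℂ) where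
  carrier := {f | IsConvergentSeries f}
  mul_mem' := IsConvergentSeries.mul
  add_mem' := IsConvergentSeries.add
  algebraMap_mem' := IsConvergentSeries.algebraMap

/-- `𝒪 = ℂ{x, y}`. -/
def ConvSeries : Type := convergentSeries

noncomputable instance : CommRing ConvSeries := inferInstanceAs (CommRing convergentSeries)

noncomputable instance : Algebra ℂ ConvSeries := inferInstanceAs (Algebra ℂ convergentSeries)

/-- The inclusion of `ℂ{x, y}` into `ℂ⟦x, y⟧`. -/
noncomputable def ConvSeries.toSeries : ConvSeries →ₐ[ℂ] MvPowerSeries (Fin 2) ℂ :=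
  convergentSeries.val

/-- The `ℂ`-algebra of linear differential operators with coefficients in `𝒪 = ℂ{x, y}`: the
subalgebra of `End_ℂ(𝒪)` generated by the multiplications by elements of `𝒪` and by the
`ℂ`-derivations of `𝒪` (which are the operators `b ∂_x + c ∂_y` with `b, c ∈ 𝒪`). -/
noncomputable def diffOps : Subalgebra ℂ (Module.End ℂ ConvSeries) :=
  Algebra.adjoin ℂ
    (Set.range (fun a : ConvSeries => LinearMap.mulLeft ℂ a) ∪
      Set.range (fun δ : Derivation ℂ ConvSeries ConvSeries =>
        (δ : ConvSeries →ₗ[ℂ] ConvSeries)))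

/-- The ring `𝒟`. -/
def DiffOp : Type := diffOps

noncomputable instance : Ring DiffOp := inferInstanceAs (Ring diffOps)

noncomputable instance : Algebra ℂ DiffOp := inferInstanceAs (Algebra ℂ diffOps)

/-- An element `a` of `𝒪` as an operator of order zero. -/
noncomputable def DiffOp.ofFun (a : ConvSeries) : DiffOp :=
  show diffOps from ⟨LinearMap.mulLeft ℂ a, Algebra.subset_adjoin (Or.inl ⟨a, rfl⟩)⟩

/-- A derivation of `𝒪` as a differential operator. -/
noncomputable def DiffOp.ofDer (δ : Derivation ℂ ConvSeries ConvSeries) : DiffOp :=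
  show diffOps from ⟨(δ : ConvSeries →ₗ[ℂ] ConvSeries), Algebra.subset_adjoin (Or.inr ⟨δ, rfl⟩)⟩

/-- `Der(log f)`: the `𝒪`-module of the derivations `δ` with `δ(f) = a f` for some `a ∈ 𝒪`. -/
noncomputable def derLog (f : ConvSeries) : Submodule ConvSeries (Derivation ℂ ConvSeries ConvSeries) where
  carrier := {δ | ∃ a : ConvSeries, δ f = a * f}
  zero_mem' := ⟨0, by simp⟩
  add_mem' := by
    rintro δ ε ⟨a, ha⟩ ⟨b, hb⟩
    exact ⟨a + b, by rw [Derivation.add_apply, ha, hb, add_mul]⟩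
  smul_mem' := by
    rintro c δ ⟨a, ha⟩
    exact ⟨c * a, by rw [Derivation.smul_apply, ha, smul_eq_mul, mul_assoc]⟩

/-- The left ideal of `𝒟` generated by the operators `δ + a` with `δ(f) = a f`
(submodules of `𝒟` as a module over itself are left ideals). -/
noncomputable def tildeILog (f : ConvSeries) : Submodule DiffOp DiffOp :=
  Submodule.span DiffOp
    {P | ∃ (δ : Derivation ℂ ConvSeries ConvSeries) (a : ConvSeries),
      δ f = a * f ∧ P = DiffOp.ofDer δ + DiffOp.ofFun a}

/-- The left `𝒟`-module `𝒟` modulo the left ideal generated by the `δ + a`. -/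
abbrev TildeMLog (f : ConvSeries) : Type := DiffOp ⧸ tildeILog f

/-- The map `𝒟 → 𝒟²`, `P ↦ (P * u, P * v)` of left `𝒟`-modules given by the row `(u, v)`. -/
noncomputable def rowMap (u v : DiffOp) : DiffOp →ₗ[DiffOp] (Fin 2 → DiffOp) :=
  LinearMap.toSpanSingleton DiffOp (Fin 2 → DiffOp) ![u, v]

/-- The map `𝒟² → 𝒟`, `(P, Q) ↦ P * u + Q * v` of left `𝒟`-modules given by the column
with entries `u, v`. -/
noncomputable def columnMap (u v : DiffOp) : (Fin 2 → DiffOp) →ₗ[DiffOp] DiffOp :=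
  Fintype.linearCombination DiffOp ![u, v]

theorem rowMap_apply (u v P : DiffOp) : rowMap u v P = ![P * u, P * v] := by
  ext i
  fin_cases i <;> simp [rowMap]

theorem columnMap_apply (u v : DiffOp) (P : Fin 2 → DiffOp) :
    columnMap u v P = P 0 * u + P 1 * v := by
  simp [columnMap, Fintype.linearCombination_apply, Fin.sum_univ_two]

/-! Filter `𝒟` by order. Every operator is uniquely `∑ a_m ∂^m`, and right multiplication by `δ + a`
multiplies the leading symbol by the linear form `σ(δ) = δ(x) ξ + δ(y) η`. On leading symbols the
sequence is therefore the Koszul complex of `σ(δ₁), σ(δ₂)` over `𝒪[ξ, η]`. Since this ring is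
factorial, the complex is exact as soon as the two forms are coprime (`isRelPrime_derSymbol`).

A common irreducible factor has degree 0 or 1. In degree 1 the two symbols are proportional over
`𝒪`, against linear independence. In degree 0 it is a prime `p` of `𝒪` dividing the coefficients of
every logarithmic derivation; those of `f ∂_x` and `f_y ∂_x - f_x ∂_y` give `p ∣ f, f_x, f_y`, hence
`p² ∣ f`, against reducedness.

Applying the bracket relation to `f` shows that `φ₁ ∘ φ₂ = 0`. Conversely, a syzygy has leading
symbols given by a Koszul syzygy; subtracting the corresponding multiple of the row `φ₂` lowers the
order, and induction finishes (`exists_eq_mul_of_mul_add_mul_eq_zero`).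

Factoriality of `𝒪` rests on Weierstrass division, proved by a contraction argument in weighted
`ℓ¹`-norms. -/

section

/-! ### Weighted `ℓ¹`-norms and convergence -/

open MvPowerSeries Finsupp

/-- The weight `∏ i, ρ i ^ m i` of an exponent `m`. -/
noncomputable def expWeight (ρ : Fin 2 → ENNReal) (m : Fin 2 →₀ ℕ) : ENNReal := ∏ i, ρ i ^ m i

theorem expWeight_add (ρ : Fin 2 → ENNReal) (m n : Fin 2 →₀ ℕ) :
    expWeight ρ (m + n) = expWeight ρ m * expWeight ρ n := by
  simp [expWeight, pow_add, Finset.prod_mul_distrib]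

theorem expWeight_single (ρ : Fin 2 → ENNReal) (i : Fin 2) (n : ℕ) :
    expWeight ρ (single i n) = ρ i ^ n := by
  fin_cases i <;> simp [expWeight]

theorem expWeight_mono {ρ τ : Fin 2 → ENNReal} (h : ρ ≤ τ) (m : Fin 2 →₀ ℕ) :
    expWeight ρ m ≤ expWeight τ m :=
  Finset.prod_le_prod' fun i _ => pow_le_pow_left' (h i) _

theorem expWeight_const (r : ENNReal) (m : Fin 2 →₀ ℕ) :
    expWeight (fun _ => r) m = r ^ m.degree := by
  rw [expWeight, Finset.prod_pow_eq_pow_sum, Finsupp.degree_eq_sum]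

theorem expWeight_ne_zero {ρ : Fin 2 → ENNReal} (h : ∀ i, ρ i ≠ 0) (m : Fin 2 →₀ ℕ) :
    expWeight ρ m ≠ 0 :=
  Finset.prod_ne_zero_iff.2 fun i _ => pow_ne_zero _ (h i)

/-- The weighted `ℓ¹`-norm of a power series, for the weight `ρ i` of the variable `i`. -/
noncomputable def wnorm (ρ : Fin 2 → ENNReal) (f : MvPowerSeries (Fin 2) ℂ) : ENNReal :=
  ∑' m, ‖coeff m f‖ₑ * expWeight ρ m

theorem wnorm_mono {ρ τ : Fin 2 → ENNReal} (h : ρ ≤ τ) (f : MvPowerSeries (Fin 2) ℂ) :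
    wnorm ρ f ≤ wnorm τ f :=
  ENNReal.tsum_le_tsum fun m => mul_le_mul_right (expWeight_mono h m) _

theorem wnorm_add_le (ρ : Fin 2 → ENNReal) (f g : MvPowerSeries (Fin 2) ℂ) :
    wnorm ρ (f + g) ≤ wnorm ρ f + wnorm ρ g := by
  rw [wnorm, wnorm, wnorm, ← ENNReal.tsum_add]
  refine ENNReal.tsum_le_tsum fun m => ?_
  rw [← add_mul, map_add]
  exact mul_le_mul_left (enorm_add_le _ _) _

/-- A product of two sums in `ENNReal` regroups freely along antidiagonals; there the triangle
inequality bounds each coefficient of the product. -/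
theorem wnorm_mul_le (ρ : Fin 2 → ENNReal) (f g : MvPowerSeries (Fin 2) ℂ) :
    wnorm ρ (f * g) ≤ wnorm ρ f * wnorm ρ g := by
  have key : wnorm ρ f * wnorm ρ g = ∑' m, ∑ p ∈ Finset.HasAntidiagonal.antidiagonal m,
      (‖coeff p.1 f‖ₑ * expWeight ρ p.1) * (‖coeff p.2 g‖ₑ * expWeight ρ p.2) := by
    rw [wnorm, wnorm, ← ENNReal.tsum_mul_right]
    simp_rw [← ENNReal.tsum_mul_left]
    rw [← ENNReal.tsum_prod (f := fun a b =>
        (‖coeff a f‖ₑ * expWeight ρ a) * (‖coeff b g‖ₑ * expWeight ρ b)),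
      ← Finset.HasAntidiagonal.sigmaAntidiagonalEquivProd.tsum_eq, ENNReal.tsum_sigma']
    refine tsum_congr fun m => ?_
    rw [tsum_fintype]
    exact Finset.sum_coe_sort (Finset.HasAntidiagonal.antidiagonal m) fun p =>
      ‖coeff p.1 f‖ₑ * expWeight ρ p.1 * (‖coeff p.2 g‖ₑ * expWeight ρ p.2)
  rw [key]
  refine ENNReal.tsum_le_tsum fun m => ?_
  rw [coeff_mul]
  refine (mul_le_mul_left (enorm_sum_le _ _) _).trans (le_of_eq ?_)
  rw [Finset.sum_mul]
  refine Finset.sum_congr rfl fun p hp => ?_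
  rw [← Finset.HasAntidiagonal.mem_antidiagonal.1 hp, expWeight_add, enorm_mul]
  ring

theorem wnorm_monomial (ρ : Fin 2 → ENNReal) (n : Fin 2 →₀ ℕ) (a : ℂ) :
    wnorm ρ (monomial n a) = ‖a‖ₑ * expWeight ρ n := by
  classical
  rw [wnorm, tsum_eq_single n]
  · rw [coeff_monomial_same]
  · intro m hm
    rw [coeff_monomial_ne hm]; simp

/-- The smaller of the two radii serves both variables. Distinct radii are needed in Weierstrass
division. -/
theorem isConvergentSeries_of_wnorm {ρ : Fin 2 → ENNReal} (h0 : ∀ i, ρ i ≠ 0)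
    (h : ∀ i, ρ i ≠ ⊤) {f : MvPowerSeries (Fin 2) ℂ} (hf : wnorm ρ f ≠ ⊤) :
    IsConvergentSeries f := by
  set t : ENNReal := min (ρ 0) (ρ 1) with ht
  have htop : t ≠ ⊤ := ne_top_of_le_ne_top (h 0) (min_le_left _ _)
  have hpos : t ≠ 0 := by
    intro h'
    rcases min_choice (ρ 0) (ρ 1) with h1 | h1
    · exact h0 0 (by rw [← h1, ← ht, h'])
    · exact h0 1 (by rw [← h1, ← ht, h'])
  have hle : wnorm (fun _ => t) f ≤ wnorm ρ f := wnorm_mono (fun i => by fin_cases i <;> simp [t]) f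
  refine ⟨t.toReal, ENNReal.toReal_pos hpos htop, ?_⟩
  have := ENNReal.summable_toReal (ne_top_of_le_ne_top hf hle)
  refine this.congr fun m => ?_
  rw [expWeight_const, ENNReal.toReal_mul, ENNReal.toReal_pow, toReal_enorm]

/-- Finiteness for all smaller weights at once allows the radii to be shrunk later, one after the
other. -/
theorem IsConvergentSeries.exists_wnorm {f : MvPowerSeries (Fin 2) ℂ} (hf : IsConvergentSeries f) :
    ∃ r : NNReal, 0 < r ∧ ∀ ρ : Fin 2 → ENNReal, (∀ i, ρ i ≤ r) → wnorm ρ f ≠ ⊤ := by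
  obtain ⟨r, hr, hs⟩ := hf
  refine ⟨r.toNNReal, Real.toNNReal_pos.2 hr, fun ρ hρ => ?_⟩
  refine ne_top_of_le_ne_top hs.tsum_ofReal_ne_top ((wnorm_mono hρ f).trans (le_of_eq ?_))
  refine tsum_congr fun m => ?_
  rw [expWeight_const, ENNReal.ofReal_mul (norm_nonneg _), ofReal_norm, ENNReal.ofReal_pow hr.le]
  rfl

/-- The power series with coefficients `m ↦ f (m + n e_i)`. -/
noncomputable def shiftSeries (i : Fin 2) (n : ℕ) (f : MvPowerSeries (Fin 2) ℂ) :
    MvPowerSeries (Fin 2) ℂ := fun m => coeff (m + single i n) f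

theorem coeff_shiftSeries (i : Fin 2) (n : ℕ) (f : MvPowerSeries (Fin 2) ℂ) (m : Fin 2 →₀ ℕ) :
    coeff m (shiftSeries i n f) = coeff (m + single i n) f := rfl

theorem shiftSeries_mul (i : Fin 2) (n : ℕ) (f : MvPowerSeries (Fin 2) ℂ) :
    shiftSeries i n (X i ^ n * f) = f := by
  ext m
  rw [coeff_shiftSeries, X_pow_eq, add_comm, coeff_add_monomial_mul, one_mul]

theorem coeff_sub_shiftSeries (i : Fin 2) (n : ℕ) (f : MvPowerSeries (Fin 2) ℂ)
    (m : Fin 2 →₀ ℕ) :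
    coeff m (f - X i ^ n * shiftSeries i n f) = if n ≤ m i then 0 else coeff m f := by
  rw [map_sub, X_pow_eq, coeff_monomial_mul]
  by_cases h : n ≤ m i
  · rw [if_pos h, if_pos (Finsupp.single_le_iff.2 h), coeff_shiftSeries,
      tsub_add_cancel_of_le (Finsupp.single_le_iff.2 h)]
    simp
  · rw [if_neg h, if_neg (mt Finsupp.single_le_iff.1 h), sub_zero]

/-- Translation of exponents is injective, so the left side is a subsum of the right side. -/
theorem wnorm_shiftSeries_le (ρ : Fin 2 → ENNReal) (i : Fin 2) (n : ℕ)
    (f : MvPowerSeries (Fin 2) ℂ) : ρ i ^ n * wnorm ρ (shiftSeries i n f) ≤ wnorm ρ f := by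
  rw [wnorm, ← ENNReal.tsum_mul_left]
  refine le_trans (le_of_eq (tsum_congr fun m => ?_))
    (ENNReal.tsum_comp_le_tsum_of_injective (add_left_injective (single i n))
      fun m => ‖coeff m f‖ₑ * expWeight ρ m)
  simp only [coeff_shiftSeries, expWeight_add, expWeight_single]
  ring

theorem IsConvergentSeries.shiftSeries {f : MvPowerSeries (Fin 2) ℂ} (hf : IsConvergentSeries f)
    (i : Fin 2) (n : ℕ) : IsConvergentSeries (shiftSeries i n f) := by
  obtain ⟨r, hr, h⟩ := hf.exists_wnorm
  have hr' : (r : ENNReal) ≠ 0 := by simpa using hr.ne'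
  refine isConvergentSeries_of_wnorm (ρ := fun _ => r) (fun _ => hr') (fun _ => by simp) ?_
  intro h'
  have := wnorm_shiftSeries_le (fun _ => (r : ENNReal)) i n f
  rw [h', ENNReal.mul_top (pow_ne_zero _ hr')] at this
  exact h _ (fun _ => le_rfl) (top_le_iff.1 this)

theorem IsConvergentSeries.monomial (n : Fin 2 →₀ ℕ) (a : ℂ) :
    IsConvergentSeries (MvPowerSeries.monomial n a) := by
  refine isConvergentSeries_of_wnorm (ρ := fun _ => 1) (by simp) (by simp) ?_
  rw [wnorm_monomial, expWeight_const]
  simp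

theorem IsConvergentSeries.X_pow (i : Fin 2) (n : ℕ) :
    IsConvergentSeries (X i ^ n : MvPowerSeries (Fin 2) ℂ) := by
  rw [X_pow_eq]; exact .monomial _ _

theorem IsConvergentSeries.sub {f g : MvPowerSeries (Fin 2) ℂ} (hf : IsConvergentSeries f)
    (hg : IsConvergentSeries g) : IsConvergentSeries (f - g) :=
  convergentSeries.sub_mem (x := f) (y := g) hf hg

/-! ### Coefficientwise sums and Weierstrass division -/

/-- A coefficientwise sum of power series with summable weighted norms. -/
theorem summable_coeff_of_tsum_wnorm {ρ : Fin 2 → ENNReal} (h0 : ∀ i, ρ i ≠ 0)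
    {d : ℕ → MvPowerSeries (Fin 2) ℂ} (hd : ∑' k, wnorm ρ (d k) ≠ ⊤) (m : Fin 2 →₀ ℕ) :
    Summable fun k => coeff m (d k) := by
  have h1 : (∑' k, ‖coeff m (d k)‖ₑ) * expWeight ρ m ≠ ⊤ := by
    rw [← ENNReal.tsum_mul_right]
    refine ne_top_of_le_ne_top hd (ENNReal.tsum_le_tsum fun k => ?_)
    exact ENNReal.le_tsum (f := fun m => ‖coeff m (d k)‖ₑ * expWeight ρ m) m
  have h2 : ∑' k, ‖coeff m (d k)‖ₑ ≠ ⊤ := fun h =>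
    h1 (by rw [h, ENNReal.top_mul (expWeight_ne_zero h0 m)])
  refine Summable.of_norm ((ENNReal.summable_toReal h2).congr fun k => ?_)
  rw [toReal_enorm]

/-- The coefficientwise sum of a sequence of power series. -/
noncomputable def coeffTsum (d : ℕ → MvPowerSeries (Fin 2) ℂ) : MvPowerSeries (Fin 2) ℂ :=
  fun m => ∑' k, coeff m (d k)

theorem coeff_coeffTsum (d : ℕ → MvPowerSeries (Fin 2) ℂ) (m : Fin 2 →₀ ℕ) :
    coeff m (coeffTsum d) = ∑' k, coeff m (d k) := rfl

theorem wnorm_coeffTsum_le (ρ : Fin 2 → ENNReal) (d : ℕ → MvPowerSeries (Fin 2) ℂ) :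
    wnorm ρ (coeffTsum d) ≤ ∑' k, wnorm ρ (d k) := by
  simp only [wnorm, coeff_coeffTsum]
  rw [ENNReal.tsum_comm]
  refine ENNReal.tsum_le_tsum fun m => ?_
  rw [ENNReal.tsum_mul_right]
  exact mul_le_mul_left enorm_tsum_le_tsum_enorm _

theorem sum_mul_tsum {ι : Type*} (S : Finset ι) (u : ι → ℂ) (v : ι → ℕ → ℂ)
    (hv : ∀ p, Summable (v p)) :
    ∑ p ∈ S, u p * ∑' k, v p k = ∑' k, ∑ p ∈ S, u p * v p k := by
  rw [Summable.tsum_finsetSum fun p _ => (hv p).mul_left (u p)]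
  exact Finset.sum_congr rfl fun p _ => tsum_mul_left.symm

theorem coeff_mul_coeffTsum (h : MvPowerSeries (Fin 2) ℂ) {d : ℕ → MvPowerSeries (Fin 2) ℂ}
    (hd : ∀ m, Summable fun k => coeff m (d k)) (m : Fin 2 →₀ ℕ) :
    coeff m (h * coeffTsum d) = ∑' k, coeff m (h * d k) := by
  rw [coeff_mul]
  have h1 : ∀ k, coeff m (h * d k) = ∑ p ∈ Finset.HasAntidiagonal.antidiagonal m,
      coeff p.1 h * coeff p.2 (d k) := fun k => coeff_mul _ _ _
  rw [tsum_congr h1]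
  have h2 : ∀ p : (Fin 2 →₀ ℕ) × (Fin 2 →₀ ℕ), Summable fun k => coeff p.2 (d k) :=
    fun p => hd p.2
  have h3 := sum_mul_tsum (Finset.HasAntidiagonal.antidiagonal m) (fun p => coeff p.1 h)
    (fun p k => coeff p.2 (d k)) h2
  exact h3

/-- The solution is the Neumann series `∑ T^k b` of the linear map `T c = a • shiftSeries 1 n (h *
c)`. It is summed coefficient by coefficient, and the halving of norms makes it converge
geometrically. -/
theorem exists_fixed_point_of_contraction {ρ : Fin 2 → ENNReal} (h0 : ∀ i, ρ i ≠ 0)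
    (n : ℕ) (a : ℂ) (h b : MvPowerSeries (Fin 2) ℂ)
    (hT : ∀ c, wnorm ρ (a • shiftSeries 1 n (h * c)) ≤ 2⁻¹ * wnorm ρ c)
    (hb : wnorm ρ b ≠ ⊤) :
    ∃ c, wnorm ρ c ≠ ⊤ ∧ c = b + a • shiftSeries 1 n (h * c) := by
  set T : MvPowerSeries (Fin 2) ℂ → MvPowerSeries (Fin 2) ℂ :=
    fun c => a • shiftSeries 1 n (h * c) with hTdef
  set d : ℕ → MvPowerSeries (Fin 2) ℂ := fun k => T^[k] b with hd
  have hnorm : ∀ k, wnorm ρ (d k) ≤ 2⁻¹ ^ k * wnorm ρ b := by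
    intro k
    induction k with
    | zero => simp [d]
    | succ k ih =>
      have : d (k + 1) = T (d k) := Function.iterate_succ_apply' _ _ _
      rw [this, pow_succ', mul_assoc]
      exact (hT _).trans (mul_le_mul_right ih _)
  have hsum : ∑' k, wnorm ρ (d k) ≠ ⊤ := by
    refine ne_top_of_le_ne_top ?_ (ENNReal.tsum_le_tsum hnorm)
    rw [ENNReal.tsum_mul_right, ENNReal.tsum_geometric]
    refine ENNReal.mul_ne_top ?_ hb
    simp
  have hcoeff := summable_coeff_of_tsum_wnorm h0 hsum
  refine ⟨coeffTsum d, ne_top_of_le_ne_top hsum (wnorm_coeffTsum_le ρ d), ?_⟩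
  ext m
  have h1 : ∀ k, coeff m (d (k + 1)) = a * coeff (m + single 1 n) (h * d k) := by
    intro k
    have : d (k + 1) = T (d k) := Function.iterate_succ_apply' _ _ _
    rw [this, hTdef, coeff_smul, coeff_shiftSeries]
  rw [map_add, coeff_smul, coeff_shiftSeries, coeff_mul_coeffTsum _ hcoeff, coeff_coeffTsum,
    (hcoeff m).tsum_eq_zero_add, tsum_congr h1, tsum_mul_left]
  rfl

/-- Weierstrass division: if `p(0, y)` has order `n`, every convergent series is a multiple of `p`
up to a convergent remainder of degree less than `n` in `y`. -/
theorem IsConvergentSeries.exists_weierstrass_div {p b : MvPowerSeries (Fin 2) ℂ}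
    (hp : IsConvergentSeries p) (hb : IsConvergentSeries b) {n : ℕ}
    (hlt : ∀ j < n, coeff (single 1 j) p = 0) (hn : coeff (single 1 n) p ≠ 0) :
    ∃ c, IsConvergentSeries c ∧ ∀ m : Fin 2 →₀ ℕ, n ≤ m 1 → coeff m (b - p * c) = 0 := by
  set a := coeff (single 1 n) p with ha
  -- With `p = a yⁿ + h`, the condition on the remainder says that the `n`-fold `y`-shift of `b - p
  -- c` vanishes, that is, `c = a⁻¹ shift(b) - a⁻¹ shift(h c)`.
  set h := p - MvPowerSeries.monomial (single 1 n) a with hh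
  have hconv : IsConvergentSeries h := hp.sub (.monomial _ _)
  -- `h` has no term `y^j` with `j ≤ n`, so it splits as `y^(n+1) g + x q`.
  set g := _root_.shiftSeries 1 (n + 1) h with hg
  have hgconv : IsConvergentSeries g := hconv.shiftSeries _ _
  have hconv2 : IsConvergentSeries (h - X 1 ^ (n + 1) * g) :=
    hconv.sub (.mul (.X_pow _ _) hgconv)
  have hdvd : (X 0 : MvPowerSeries (Fin 2) ℂ) ∣ h - X 1 ^ (n + 1) * g := by
    rw [X_dvd_iff]
    intro m hm
    rw [hg, coeff_sub_shiftSeries]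
    split_ifs with hnm
    · rfl
    · have hms : m = single 1 (m 1) := by
        ext i; fin_cases i <;> simp [hm]
      rw [hh, map_sub, hms]
      rcases lt_or_eq_of_le (Nat.lt_succ_iff.1 (not_le.1 hnm)) with h' | h'
      · rw [hlt _ h', coeff_monomial_ne]
        · simp
        · intro h''
          have := DFunLike.congr_fun h'' 1
          simp at this; omega
      · rw [h', coeff_monomial_same, ha, sub_self]
  obtain ⟨q, hq⟩ := hdvd
  have hqconv : IsConvergentSeries q := by
    have := (hq ▸ hconv2).shiftSeries 0 1
    rwa [← pow_one (X 0), shiftSeries_mul] at this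
  have hsplit : h = X 1 ^ (n + 1) * g + X 0 ^ 1 * q := by rw [pow_one, ← hq]; ring
  obtain ⟨r₁, hr₁, hr₁'⟩ := hgconv.exists_wnorm
  obtain ⟨r₂, hr₂, hr₂'⟩ := hqconv.exists_wnorm
  obtain ⟨r₃, hr₃, hr₃'⟩ := hb.exists_wnorm
  set r := min r₁ (min r₂ r₃) with hr
  have hrpos : 0 < r := lt_min hr₁ (lt_min hr₂ hr₃)
  have hG := hr₁' (fun _ => (r : ENNReal)) fun _ => by simp [hr]
  have hQ := hr₂' (fun _ => (r : ENNReal)) fun _ => by simp [hr]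
  have hB := hr₃' (fun _ => (r : ENNReal)) fun _ => by simp [hr]
  set A : ENNReal := ‖a‖ₑ with hA
  have hA0 : A ≠ 0 := by simpa [hA] using hn
  have hAtop : A ≠ ⊤ := enorm_ne_top
  have hA4 : A * 4⁻¹ ≠ 0 := mul_ne_zero hA0 (by simp)
  -- The `y`-radius is chosen first, making `y^(n+1) g` at most a quarter of `|a| s'ⁿ`. The
  -- `x`-radius comes after it, because the bound required of `x q` itself involves `s'ⁿ`. Together
  -- `h` has at most half the norm of `a yⁿ`.
  obtain ⟨s, hs, hs'⟩ := ENNReal.exists_nnreal_pos_mul_lt hG hA4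
  set s' := min s r with hs'def
  have hs'pos : 0 < s' := lt_min hs hrpos
  have hs'0 : (s' : ENNReal) ≠ 0 := by simpa using hs'pos.ne'
  have hb2 : A * 4⁻¹ * (s' : ENNReal) ^ n ≠ 0 := mul_ne_zero hA4 (pow_ne_zero _ hs'0)
  obtain ⟨t, ht, ht'⟩ := ENNReal.exists_nnreal_pos_mul_lt hQ hb2
  set t' := min t r with ht'def
  have ht'pos : 0 < t' := lt_min ht hrpos
  have ht'0 : (t' : ENNReal) ≠ 0 := by simpa using ht'pos.ne'
  set ρ : Fin 2 → ENNReal := ![(t' : ENNReal), (s' : ENNReal)] with hρ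
  have hρ0 : ∀ i, ρ i ≠ 0 := fun i => by fin_cases i <;> assumption
  have hρtop : ∀ i, ρ i ≠ ⊤ := fun i => by fin_cases i <;> exact ENNReal.coe_ne_top
  have hρr : ρ ≤ fun _ => (r : ENNReal) := fun i => by
    fin_cases i
    · exact ENNReal.coe_le_coe.2 (min_le_right _ _)
    · exact ENNReal.coe_le_coe.2 (min_le_right _ _)
  have hwX : ∀ i k, wnorm ρ (X i ^ k) = ρ i ^ k := fun i k => by
    rw [X_pow_eq, wnorm_monomial, expWeight_single]; simp
  have hhnorm : wnorm ρ h ≤ 2⁻¹ * A * ρ 1 ^ n := by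
    have h1 : wnorm ρ (X 1 ^ (n + 1) * g) ≤ A * 4⁻¹ * ρ 1 ^ n := by
      refine (wnorm_mul_le _ _ _).trans ?_
      rw [hwX, pow_succ, mul_assoc, mul_comm]
      refine mul_le_mul_left (le_trans ?_ hs'.le) _
      refine mul_le_mul' ?_ (wnorm_mono hρr g)
      exact ENNReal.coe_le_coe.2 (min_le_left _ _)
    have h2 : wnorm ρ (X 0 ^ 1 * q) ≤ A * 4⁻¹ * ρ 1 ^ n := by
      refine (wnorm_mul_le _ _ _).trans (le_trans ?_ ht'.le)
      rw [hwX, pow_one]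
      refine mul_le_mul' ?_ (wnorm_mono hρr q)
      exact ENNReal.coe_le_coe.2 (min_le_left _ _)
    rw [hsplit]
    refine (wnorm_add_le _ _ _).trans ((add_le_add h1 h2).trans (le_of_eq ?_))
    have h42 : (4⁻¹ : ENNReal) + 4⁻¹ = 2⁻¹ := by
      have h4 : (4⁻¹ : ENNReal) = 2⁻¹ * 2⁻¹ := by
        rw [← ENNReal.mul_inv (by simp) (by simp)]; norm_num
      rw [h4, ← mul_add, ENNReal.inv_two_add_inv_two, mul_one]
    rw [← add_mul, ← mul_add, h42, mul_comm A]
  have hwsmul : ∀ (z : ℂ) f, wnorm ρ (z • f) = ‖z‖ₑ * wnorm ρ f := fun z f => by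
    rw [wnorm, wnorm, ← ENNReal.tsum_mul_left]
    refine tsum_congr fun m => ?_
    rw [coeff_smul, enorm_mul, mul_assoc]
  have hinv : ‖a⁻¹‖ₑ * A = 1 := by
    rw [hA, ← enorm_mul, inv_mul_cancel₀ hn, enorm_one]
  have hpn : ρ 1 ^ n ≠ 0 := pow_ne_zero _ (hρ0 1)
  have hpn' : ρ 1 ^ n ≠ ⊤ := ENNReal.pow_ne_top (hρtop 1)
  have hT : ∀ c, wnorm ρ ((-a⁻¹) • _root_.shiftSeries 1 n (h * c)) ≤ 2⁻¹ * wnorm ρ c := by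
    intro c
    rw [hwsmul, enorm_neg]
    rw [← ENNReal.mul_le_mul_iff_right hpn hpn']
    calc ρ 1 ^ n * (‖a⁻¹‖ₑ * wnorm ρ (_root_.shiftSeries 1 n (h * c)))
        = ‖a⁻¹‖ₑ * (ρ 1 ^ n * wnorm ρ (_root_.shiftSeries 1 n (h * c))) := by ring
      _ ≤ ‖a⁻¹‖ₑ * (2⁻¹ * A * ρ 1 ^ n * wnorm ρ c) := by
          refine mul_le_mul_right ((wnorm_shiftSeries_le _ _ _ _).trans
            ((wnorm_mul_le _ _ _).trans (mul_le_mul_left hhnorm _))) _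
      _ = (‖a⁻¹‖ₑ * A) * (ρ 1 ^ n * (2⁻¹ * wnorm ρ c)) := by ring
      _ = ρ 1 ^ n * (2⁻¹ * wnorm ρ c) := by rw [hinv, one_mul]
  have hb' : wnorm ρ (a⁻¹ • _root_.shiftSeries 1 n b) ≠ ⊤ := by
    rw [hwsmul]
    refine ENNReal.mul_ne_top enorm_ne_top fun h' => ?_
    have := wnorm_shiftSeries_le ρ 1 n b
    rw [h', ENNReal.mul_top hpn] at this
    exact ne_top_of_le_ne_top hB (wnorm_mono hρr b) (top_le_iff.1 this)
  obtain ⟨c, hc, hfix⟩ := exists_fixed_point_of_contraction hρ0 n (-a⁻¹) h _ hT hb'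
  refine ⟨c, isConvergentSeries_of_wnorm hρ0 hρtop hc, fun m hm => ?_⟩
  have hle : single 1 n ≤ m := Finsupp.single_le_iff.2 hm
  -- The coefficient of the fixed-point equation at `m - n e_y`, times `a`, is the required identity
  -- at `m`.
  have hm' := congrArg (fun u => a * coeff (m - single 1 n) u) hfix
  simp only [map_add, coeff_smul, coeff_shiftSeries, tsub_add_cancel_of_le hle] at hm'
  have hpc : p * c = h * c + MvPowerSeries.monomial (single 1 n) a * c := by rw [hh]; ring
  rw [map_sub, hpc, map_add, coeff_monomial_mul, if_pos hle, hm']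
  field_simp
  ring

/-! ### Factoriality of `ℂ{x, y}` -/

namespace ConvSeries

theorem toSeries_injective : Function.Injective toSeries := Subtype.val_injective

theorem ext_coeff {a b : ConvSeries} (h : ∀ m, coeff m a.toSeries = coeff m b.toSeries) : a = b :=
  toSeries_injective (MvPowerSeries.ext h)

theorem isConvergentSeries (a : ConvSeries) : IsConvergentSeries a.toSeries := Subtype.prop a

/-- A convergent power series as an element of `ℂ{x, y}`. -/
def mk (f : MvPowerSeries (Fin 2) ℂ) (hf : IsConvergentSeries f) : ConvSeries :=
  (⟨f, hf⟩ : convergentSeries)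

@[simp]
theorem toSeries_mk (f : MvPowerSeries (Fin 2) ℂ) (hf : IsConvergentSeries f) :
    (mk f hf).toSeries = f := rfl

theorem toSeries_ne_zero {a : ConvSeries} (ha : a ≠ 0) : a.toSeries ≠ 0 :=
  fun h => ha (toSeries_injective (h.trans (map_zero toSeries).symm))

instance : IsDomain ConvSeries :=
  have : IsDomain (MvPowerSeries (Fin 2) ℂ) := NoZeroDivisors.to_isDomain _
  toSeries_injective.isDomain toSeries.toRingHom

/-- The coordinates `x` and `y`. -/
noncomputable def var (i : Fin 2) : ConvSeries :=
  mk (X i) (by simpa using IsConvergentSeries.X_pow i 1)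

@[simp]
theorem toSeries_var (i : Fin 2) : (var i).toSeries = X i := rfl

theorem var_dvd_iff {i : Fin 2} {a : ConvSeries} :
    var i ∣ a ↔ ∀ m : Fin 2 →₀ ℕ, m i = 0 → coeff m a.toSeries = 0 := by
  rw [← X_dvd_iff]
  refine ⟨fun ⟨b, hb⟩ => ⟨b.toSeries, by rw [hb, map_mul, toSeries_var]⟩, fun ⟨q, hq⟩ => ?_⟩
  have hconv : IsConvergentSeries q := by
    have := (hq ▸ a.isConvergentSeries).shiftSeries i 1
    rwa [← pow_one (X i), shiftSeries_mul] at this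
  exact ⟨mk q hconv, toSeries_injective (by rw [hq, map_mul, toSeries_var, toSeries_mk])⟩

theorem not_var_zero_dvd_iff {a : ConvSeries} :
    ¬ var 0 ∣ a ↔ ∃ j, coeff (single 1 j) a.toSeries ≠ 0 := by
  rw [var_dvd_iff]
  push Not
  constructor
  · rintro ⟨m, hm, h⟩
    refine ⟨m 1, ?_⟩
    have : single 1 (m 1) = m := by
      ext i; fin_cases i <;> simp [hm]
    rwa [this]
  · rintro ⟨j, hj⟩
    exact ⟨single 1 j, by simp, hj⟩

theorem exists_weierstrass_div (p b : ConvSeries) {n : ℕ}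
    (hlt : ∀ j < n, coeff (single 1 j) p.toSeries = 0)
    (hn : coeff (single 1 n) p.toSeries ≠ 0) :
    ∃ c, ∀ m : Fin 2 →₀ ℕ, n ≤ m 1 → coeff m (b - p * c).toSeries = 0 := by
  obtain ⟨c, hc, h⟩ := p.isConvergentSeries.exists_weierstrass_div b.isConvergentSeries hlt hn
  exact ⟨mk c hc, fun m hm => by rw [map_sub, map_mul, toSeries_mk, h m hm]⟩

/-- Dividing `1` by `a` with `n = 0` leaves no remainder. -/
theorem isUnit_of_constantCoeff_ne_zero {a : ConvSeries} (h : constantCoeff a.toSeries ≠ 0) :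
    IsUnit a := by
  obtain ⟨c, hc⟩ := exists_weierstrass_div a 1 (n := 0) (by simp) (by simpa using h)
  refine IsUnit.of_mul_eq_one c (Eq.symm (sub_eq_zero.1 (ext_coeff fun m => ?_)))
  rw [hc m (Nat.zero_le _), map_zero, map_zero]

theorem order_pos_of_not_isUnit {a : ConvSeries} (h : ¬ IsUnit a) : 1 ≤ a.toSeries.order := by
  rw [one_le_order_iff_constCoeff_eq_zero]
  by_contra h'
  exact h (isUnit_of_constantCoeff_ne_zero h')

/-- The order is additive and positive on non-units, so it grows strictly along proper divisibility.
-/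
instance : WfDvdMonoid ConvSeries where
  wf := by
    refine Subrelation.wf (r := InvImage (· < ·) fun a : ConvSeries => a.toSeries.order) ?_
      (InvImage.wf _ wellFounded_lt)
    rintro a b ⟨ha, c, hc, rfl⟩
    have hfin : a.toSeries.order ≠ ⊤ := by
      rw [Ne, order_eq_top_iff]; exact toSeries_ne_zero ha
    change a.toSeries.order < (a * c).toSeries.order
    rw [map_mul, order_mul]
    exact (ENat.add_one_le_iff hfin).1 (add_le_add_right (order_pos_of_not_isUnit hc) _)

/-- The weighted order with weight 1 on variable `i` and 0 on the other is the `var i`-adic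
valuation, and it is additive. -/
theorem prime_var (i : Fin 2) : Prime (var i) := by
  have key : ∀ a : ConvSeries, var i ∣ a ↔ weightedOrder (Pi.single i 1) a.toSeries ≠ 0 := by
    intro a
    have hw : ∀ m : Fin 2 →₀ ℕ, weight (Pi.single i 1 : Fin 2 → ℕ) m = m i := fun m => by
      fin_cases i <;> simp [weight_apply, Finsupp.sum_fintype]
    rw [var_dvd_iff]
    constructor
    · intro h h0
      have : ((1 : ℕ) : ℕ∞) ≤ weightedOrder (Pi.single i 1) a.toSeries :=
        nat_le_weightedOrder _ fun d hd => h d (by rw [hw] at hd; omega)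
      rw [h0] at this
      simp at this
    · intro h m hm
      refine coeff_eq_zero_of_lt_weightedOrder (Pi.single i 1) ?_
      rw [hw, hm]
      exact pos_iff_ne_zero.2 h
  refine ⟨?_, ?_, fun a b => ?_⟩
  · intro h
    have := congrArg (fun a => coeff (single i 1) a.toSeries) h
    simp [coeff_index_single_self_X] at this
  · intro h
    have := var_dvd_iff.1 (h.dvd (a := 1)) 0 rfl
    simp at this
  · simp only [key, map_mul, weightedOrder_mul]
    intro h
    by_contra! h'
    exact h (by rw [h'.1, h'.2, add_zero])

theorem exists_eq_var_pow_mul {a : ConvSeries} (ha : a ≠ 0) :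
    ∃ k b, ¬ var 0 ∣ b ∧ a = var 0 ^ k * b :=
  WfDvdMonoid.max_power_factor ha (prime_var 0).irreducible

/-- A generator is any `p ∈ I` whose restriction to `x = 0` has minimal order `n`. A nonzero
remainder modulo `p` has `y`-degree below `n`; stripped of its power of `x` it stays in `I` by
saturation, and its restriction to `x = 0` is nonzero of order below `n`, a contradiction. -/
theorem exists_eq_span_singleton_of_saturated (I : Ideal ConvSeries)
    (hI : ∀ a, var 0 * a ∈ I → a ∈ I) : ∃ p, I = Ideal.span {p} := by
  classical
  have hpow : ∀ k a, var 0 ^ k * a ∈ I → a ∈ I := by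
    intro k
    induction k with
    | zero => intro a h; simpa using h
    | succ k ih => intro a h; exact ih a (hI _ (by rwa [pow_succ', mul_assoc] at h))
  by_cases hbot : I = ⊥
  · exact ⟨0, by simpa using hbot⟩
  have hex : ∃ n, ∃ p ∈ I, coeff (single 1 n) p.toSeries ≠ 0 := by
    obtain ⟨a, haI, ha⟩ := Submodule.exists_mem_ne_zero_of_ne_bot hbot
    obtain ⟨k, b, hb, rfl⟩ := exists_eq_var_pow_mul ha
    obtain ⟨j, hj⟩ := not_var_zero_dvd_iff.1 hb
    exact ⟨j, b, hpow k b haI, hj⟩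
  obtain ⟨p, hpI, hp⟩ := Nat.find_spec hex
  have hmin : ∀ j < Nat.find hex, ∀ q ∈ I, coeff (single 1 j) q.toSeries = 0 := by
    intro j hj q hq
    by_contra h
    exact Nat.find_min hex hj ⟨q, hq, h⟩
  refine ⟨p, le_antisymm (fun b hb => ?_) (by rwa [Ideal.span_singleton_le_iff_mem])⟩
  obtain ⟨c, hc⟩ := exists_weierstrass_div p b (fun j hj => hmin j hj p hpI) hp
  have hr : b - p * c ∈ I := I.sub_mem hb (I.mul_mem_right c hpI)
  by_cases h0 : b - p * c = 0
  · rw [sub_eq_zero.1 h0]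
    exact Ideal.mul_mem_right _ _ (Ideal.mem_span_singleton_self p)
  · exfalso
    obtain ⟨k, q, hq, hqe⟩ := exists_eq_var_pow_mul h0
    have hqI : q ∈ I := hpow k q (hqe ▸ hr)
    obtain ⟨j, hj⟩ := not_var_zero_dvd_iff.1 hq
    rcases lt_or_ge j (Nat.find hex) with hlt | hge
    · exact hj (hmin j hlt q hqI)
    · have h1 := hc (single 0 k + single 1 j) (by simpa using hge)
      rw [hqe, map_mul, map_pow, toSeries_var, X_pow_eq, coeff_add_monomial_mul, one_mul] at h1
      exact hj h1

/-- If `x ∤ p`, the colon ideal `(p : b)` is saturated, hence generated by some `d ∣ p`. Either `d`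
is a unit and `p ∣ b`, or `d` is associated to `p` and `p ∣ a`. -/
theorem prime_of_irreducible {p : ConvSeries} (hp : Irreducible p) : Prime p := by
  by_cases hx : var 0 ∣ p
  · exact ((prime_var 0).irreducible.associated_of_dvd hp hx).prime (prime_var 0)
  refine ⟨hp.ne_zero, hp.not_isUnit, fun a b hab => ?_⟩
  obtain ⟨d, hd⟩ := exists_eq_span_singleton_of_saturated
    (Submodule.comap (LinearMap.mulRight ConvSeries b) (Ideal.span {p})) (by
      intro u hu
      simp only [Submodule.mem_comap, LinearMap.mulRight_apply, Ideal.mem_span_singleton] at hu ⊢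
      obtain ⟨w, hw⟩ := hu
      have : var 0 ∣ p * w := ⟨u * b, by rw [← hw, mul_assoc]⟩
      obtain ⟨v, rfl⟩ := ((prime_var 0).dvd_or_dvd this).resolve_left hx
      exact ⟨v, mul_left_cancel₀ (prime_var 0).ne_zero (by linear_combination hw)⟩)
  have hmem : ∀ u, p ∣ u * b ↔ d ∣ u := by
    intro u
    rw [← Ideal.mem_span_singleton, ← Ideal.mem_span_singleton (x := u), ← hd]
    rfl
  have hdp : d ∣ p := (hmem p).1 (dvd_mul_right p b)
  rcases hp.dvd_iff.1 hdp with hu | has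
  · right
    simpa using (hmem 1).2 (hu.dvd)
  · left
    exact has.dvd.trans ((hmem a).1 hab)

instance : UniqueFactorizationMonoid ConvSeries where
  irreducible_iff_prime := ⟨prime_of_irreducible, Prime.irreducible⟩

end ConvSeries

/-! ### Derivations of `ℂ{x, y}` -/

theorem IsConvergentSeries.pderiv {f : MvPowerSeries (Fin 2) ℂ} (hf : IsConvergentSeries f)
    (i : Fin 2) : IsConvergentSeries (MvPowerSeries.pderiv ℂ i f) := by
  obtain ⟨r, hr, h⟩ := hf.shiftSeries i 1
  -- Halving the radius absorbs the factor `m i + 1 ≤ 2 ^ m.degree`.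
  refine ⟨r / 2, half_pos hr, Summable.of_nonneg_of_le (fun m => by positivity) (fun m => ?_) h⟩
  rw [coeff_pderiv, norm_mul, div_pow, coeff_shiftSeries, mul_assoc]
  refine mul_le_mul_of_nonneg_left ?_ (norm_nonneg _)
  have h1 : ‖((m i : ℂ) + 1)‖ ≤ 2 ^ m.degree := by
    have h2 : m i + 1 ≤ 2 ^ m.degree :=
      (Nat.lt_two_pow_self (n := m i)).trans_le
        (Nat.pow_le_pow_right two_pos (Finsupp.le_degree i m))
    have h3 : ((m i : ℂ) + 1) = ((m i + 1 : ℕ) : ℂ) := by push_cast; rfl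
    rw [h3, Complex.norm_natCast]
    exact_mod_cast h2
  calc ‖((m i : ℂ) + 1)‖ * (r ^ m.degree / 2 ^ m.degree)
      ≤ 2 ^ m.degree * (r ^ m.degree / 2 ^ m.degree) := by gcongr
    _ = r ^ m.degree := by field_simp

namespace ConvSeries

/-- The partial derivatives `∂_x` and `∂_y` of `ℂ{x, y}`. -/
noncomputable def pd (i : Fin 2) : Derivation ℂ ConvSeries ConvSeries :=
  Derivation.mk'
    { toFun := fun a => mk (MvPowerSeries.pderiv ℂ i a.toSeries) (a.isConvergentSeries.pderiv i)
      map_add' := fun a b => toSeries_injective (by simp)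
      map_smul' := fun c a => toSeries_injective (by simp) }
    fun a b => toSeries_injective (by simp)

@[simp]
theorem toSeries_pd (i : Fin 2) (a : ConvSeries) :
    (pd i a).toSeries = MvPowerSeries.pderiv ℂ i a.toSeries := rfl

theorem pd_var_self (i : Fin 2) : pd i (var i) = 1 :=
  toSeries_injective (by simp)

theorem pd_var_of_ne {i j : Fin 2} (h : j ≠ i) : pd i (var j) = 0 :=
  toSeries_injective (by simp [pderiv_X_of_ne h])

theorem exists_eq_add_var_mul (a : ConvSeries) :
    ∃ (c : ℂ) (b₀ b₁ : ConvSeries), a = algebraMap ℂ ConvSeries c + var 0 * b₀ + var 1 * b₁ := by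
  set b : ConvSeries := mk _ (a.isConvergentSeries.shiftSeries 1 1) with hb
  have hdvd : var 0 ∣ a - algebraMap ℂ ConvSeries (constantCoeff a.toSeries) - var 1 * b := by
    rw [var_dvd_iff]
    intro m hm
    have hms : m = single 1 (m 1) := by
      ext i; fin_cases i <;> simp [hm]
    have h1 : (a - algebraMap ℂ ConvSeries (constantCoeff a.toSeries) - var 1 * b).toSeries =
        (a.toSeries - X 1 ^ 1 * shiftSeries 1 1 a.toSeries) - C (constantCoeff a.toSeries) := by
      rw [map_sub, map_sub, map_mul, AlgHom.commutes, hb, toSeries_mk, toSeries_var, pow_one]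
      exact sub_right_comm _ _ _
    rw [h1, map_sub, coeff_sub_shiftSeries]
    split_ifs with h
    · rw [coeff_C, if_neg, sub_zero]
      intro h0; rw [h0] at h; simp at h
    · have : m = 0 := by rw [hms]; simp; omega
      rw [this]; simp
  obtain ⟨q, hq⟩ := hdvd
  exact ⟨_, q, b, by linear_combination hq⟩

/-- No continuity of `δ` is assumed: writing `a = c + x b₀ + y b₁` gives `δ a = x δ b₀ + y δ b₁`, so
by induction the coefficients of `δ a` vanish in every degree. -/
theorem derivation_eq_zero {δ : Derivation ℂ ConvSeries ConvSeries} (h : ∀ i, δ (var i) = 0) :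
    δ = 0 := by
  have key : ∀ N : ℕ, ∀ a, ∀ m : Fin 2 →₀ ℕ, m.degree < N → coeff m (δ a).toSeries = 0 := by
    intro N
    induction N with
    | zero => intro a m hm; simp at hm
    | succ N ih =>
      intro a m hm
      obtain ⟨c, b₀, b₁, rfl⟩ := exists_eq_add_var_mul a
      have haux : ∀ i b, coeff m (X i * (δ b).toSeries) = 0 := by
        intro i b
        rw [X_def, coeff_monomial_mul]
        split_ifs with hle
        · rw [one_mul]
          refine ih b _ ?_
          have := congrArg Finsupp.degree (tsub_add_cancel_of_le hle)
          rw [map_add, degree_single] at this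
          omega
        · rfl
      simp [h, haux]
  ext a
  exact ext_coeff fun m => by
    rw [key (m.degree + 1) a m (Nat.lt_succ_self _)]; simp

theorem derivation_eq (δ : Derivation ℂ ConvSeries ConvSeries) :
    δ = δ (var 0) • pd 0 + δ (var 1) • pd 1 := by
  rw [← sub_eq_zero]
  refine derivation_eq_zero fun i => ?_
  fin_cases i <;> simp [pd_var_self, pd_var_of_ne]

/-- Differentiating a monomial of lowest degree drops the order by one, whereas a multiple of `p`
has order at least that of `p`. -/
theorem exists_not_dvd_pd {p : ConvSeries} (h0 : p ≠ 0) (hu : ¬ IsUnit p) : ∃ i, ¬ p ∣ pd i p := by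
  obtain ⟨m, hm, hmo⟩ := exists_coeff_ne_zero_and_order
    (ne_zero_iff_order_finite.1 (toSeries_ne_zero h0))
  have hpos := order_pos_of_not_isUnit hu
  rw [← hmo] at hpos
  have hm0 : m ≠ 0 := by rintro rfl; simp at hpos
  obtain ⟨i, hi⟩ := Finsupp.ne_iff.1 hm0
  refine ⟨i, ?_⟩
  rintro ⟨q, hq⟩
  have hle : single i 1 ≤ m := Finsupp.single_le_iff.2 (Nat.one_le_iff_ne_zero.2 hi)
  have hdeg := congrArg Finsupp.degree (tsub_add_cancel_of_le hle)
  rw [map_add, degree_single] at hdeg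
  have h1 : coeff (m - single i 1) (pd i p).toSeries = 0 := by
    refine coeff_of_lt_order ?_
    rw [hq, map_mul, order_mul, ← hmo]
    refine lt_of_lt_of_le ?_ le_self_add
    exact_mod_cast (by omega)
  rw [toSeries_pd, coeff_pderiv, tsub_add_cancel_of_le hle] at h1
  refine (mul_ne_zero hm ?_) h1
  exact Nat.cast_add_one_ne_zero _

end ConvSeries

/-! ### Logarithmic derivations and coprimality of their symbols -/

open ConvSeries (var pd)

theorem mem_derLog_iff {f : ConvSeries} {δ : Derivation ℂ ConvSeries ConvSeries} :
    δ ∈ derLog f ↔ ∃ a : ConvSeries, δ f = a * f := Iff.rfl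

/-- The coefficients of the logarithmic derivations of a reduced `f` have no common prime factor. -/
theorem exists_derLog_not_dvd {f p : ConvSeries} (hred : Squarefree f) (hp : Prime p) :
    ∃ δ ∈ derLog f, ∃ j, ¬ p ∣ δ (var j) := by
  by_contra! h
  have hf : p ∣ f := by
    have := h (f • pd 0) (mem_derLog_iff.2 ⟨pd 0 f, by simp [mul_comm]⟩) 0
    simpa [ConvSeries.pd_var_self] using this
  have hmem : pd 1 f • pd 0 - pd 0 f • pd 1 ∈ derLog f :=
    mem_derLog_iff.2 ⟨0, by simp [mul_comm]⟩
  have hpd : ∀ i, p ∣ pd i f := by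
    intro i
    fin_cases i
    · simpa [ConvSeries.pd_var_self, ConvSeries.pd_var_of_ne] using h _ hmem 1
    · simpa [ConvSeries.pd_var_self, ConvSeries.pd_var_of_ne] using h _ hmem 0
  obtain ⟨g, rfl⟩ := hf
  -- For `f = p g`, the Leibniz rule turns `p ∣ ∂_i f` into `p ∣ g ∂_i p`; for this `i` it follows
  -- that `p ∣ g`.
  obtain ⟨i, hi⟩ := ConvSeries.exists_not_dvd_pd hp.ne_zero hp.not_isUnit
  have h1 := hpd i
  rw [Derivation.leibniz, smul_eq_mul, smul_eq_mul, dvd_add_right (dvd_mul_right _ _)] at h1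
  exact hp.not_isUnit (hred p (mul_dvd_mul_left p ((hp.dvd_or_dvd h1).resolve_right hi)))

/-- The principal symbol `b ξ + c η` of the derivation `b ∂_x + c ∂_y`. -/
noncomputable def derSymbol (δ : Derivation ℂ ConvSeries ConvSeries) :
    MvPolynomial (Fin 2) ConvSeries :=
  MvPolynomial.C (δ (var 0)) * MvPolynomial.X 0 + MvPolynomial.C (δ (var 1)) * MvPolynomial.X 1

theorem coeff_derSymbol (δ : Derivation ℂ ConvSeries ConvSeries) (j : Fin 2) :
    MvPolynomial.coeff (single j 1) (derSymbol δ) = δ (var j) := by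
  fin_cases j <;>
  simp [derSymbol, MvPolynomial.coeff_C_mul, MvPolynomial.coeff_X, Finsupp.single_left_inj]

theorem derSymbol_add (δ ε : Derivation ℂ ConvSeries ConvSeries) :
    derSymbol (δ + ε) = derSymbol δ + derSymbol ε := by
  simp only [derSymbol, Derivation.add_apply, map_add]; ring

theorem derSymbol_smul (a : ConvSeries) (δ : Derivation ℂ ConvSeries ConvSeries) :
    derSymbol (a • δ) = MvPolynomial.C a * derSymbol δ := by
  simp only [derSymbol, Derivation.smul_apply, smul_eq_mul, map_mul]; ring

theorem derSymbol_eq_zero {δ : Derivation ℂ ConvSeries ConvSeries} (h : derSymbol δ = 0) :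
    δ = 0 :=
  ConvSeries.derivation_eq_zero fun i => by rw [← coeff_derSymbol, h, MvPolynomial.coeff_zero]

theorem isHomogeneous_derSymbol (δ : Derivation ℂ ConvSeries ConvSeries) :
    (derSymbol δ).IsHomogeneous 1 :=
  (MvPolynomial.isHomogeneous_C_mul_X _ _).add (MvPolynomial.isHomogeneous_C_mul_X _ _)

/-- The symbols of a basis of the logarithmic derivations of a reduced `f` are coprime. -/
theorem isRelPrime_derSymbol {f : ConvSeries} (hred : Squarefree f)
    {δ₁ δ₂ : Derivation ℂ ConvSeries ConvSeries}
    (hspan : ∀ δ ∈ derLog f, ∃ c₁ c₂ : ConvSeries, δ = c₁ • δ₁ + c₂ • δ₂)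
    (hind : ∀ c₁ c₂ : ConvSeries, c₁ • δ₁ + c₂ • δ₂ = 0 → c₁ = 0 ∧ c₂ = 0) :
    IsRelPrime (derSymbol δ₁) (derSymbol δ₂) := by
  have h1 : derSymbol δ₁ ≠ 0 := fun h =>
    one_ne_zero (hind 1 0 (by simp [derSymbol_eq_zero h])).1
  have h2 : derSymbol δ₂ ≠ 0 := fun h =>
    one_ne_zero (hind 0 1 (by simp [derSymbol_eq_zero h])).2
  intro d hd1 hd2
  by_contra hd
  have hd0 : d ≠ 0 := by rintro rfl; exact h1 (zero_dvd_iff.1 hd1)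
  obtain ⟨q, hq, hqd⟩ := WfDvdMonoid.exists_irreducible_factor hd hd0
  obtain ⟨e₁, he₁⟩ := hqd.trans hd1
  obtain ⟨e₂, he₂⟩ := hqd.trans hd2
  have hq0 := hq.ne_zero
  have hdeg : ∀ {δ e}, derSymbol δ ≠ 0 → derSymbol δ = q * e →
      q.totalDegree + e.totalDegree = 1 := by
    intro δ e h0 he
    rw [← MvPolynomial.totalDegree_mul_of_isDomain hq0 (right_ne_zero_of_mul (he ▸ h0)), ← he]
    exact (isHomogeneous_derSymbol δ).totalDegree h0
  have hdeg1 := hdeg h1 he₁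
  have hdeg2 := hdeg h2 he₂
  by_cases hqdeg : q.totalDegree = 0
  · obtain ⟨p, rfl⟩ : ∃ p, q = MvPolynomial.C p :=
      ⟨_, MvPolynomial.totalDegree_eq_zero_iff_eq_C.1 hqdeg⟩
    have hp : Prime p := (MvPolynomial.prime_C_iff (Fin 2)).1 hq.prime
    have hdvd : ∀ {δ e}, derSymbol δ = MvPolynomial.C p * e → ∀ j, p ∣ δ (var j) := by
      intro δ e he j
      rw [← coeff_derSymbol, he, MvPolynomial.coeff_C_mul]
      exact dvd_mul_right _ _
    obtain ⟨δ, hδ, j, hj⟩ := exists_derLog_not_dvd hred hp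
    obtain ⟨c₁, c₂, rfl⟩ := hspan δ hδ
    refine hj ?_
    simp only [Derivation.add_apply, Derivation.smul_apply, smul_eq_mul]
    exact dvd_add (dvd_mul_of_dvd_right (hdvd he₁ j) _) (dvd_mul_of_dvd_right (hdvd he₂ j) _)
  · obtain ⟨c₁, rfl⟩ : ∃ c, e₁ = MvPolynomial.C c :=
      ⟨_, MvPolynomial.totalDegree_eq_zero_iff_eq_C.1 (by omega)⟩
    obtain ⟨c₂, rfl⟩ : ∃ c, e₂ = MvPolynomial.C c :=
      ⟨_, MvPolynomial.totalDegree_eq_zero_iff_eq_C.1 (by omega)⟩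
    -- The cofactors are constants, so the symbols `q c₁` and `q c₂` are proportional, and so are
    -- the derivations.
    have hzero : c₂ • δ₁ + (-c₁) • δ₂ = 0 := by
      refine derSymbol_eq_zero ?_
      rw [derSymbol_add, derSymbol_smul, derSymbol_smul, he₁, he₂, map_neg]
      ring
    have := (hind _ _ hzero).1
    rw [this, map_zero, mul_zero] at he₂
    exact h2 he₂

/-! ### Normal form of differential operators -/

namespace DiffOp

/-- The action of differential operators on `ℂ{x, y}`. -/
noncomputable def toEnd : DiffOp →ₐ[ℂ] Module.End ℂ ConvSeries := diffOps.val

theorem toEnd_injective : Function.Injective toEnd := Subtype.val_injective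

theorem ext_apply {P Q : DiffOp} (h : ∀ a, toEnd P a = toEnd Q a) : P = Q :=
  toEnd_injective (LinearMap.ext h)

@[simp]
theorem toEnd_ofFun (a b : ConvSeries) : toEnd (ofFun a) b = a * b := rfl

@[simp]
theorem toEnd_ofDer (δ : Derivation ℂ ConvSeries ConvSeries) (b : ConvSeries) :
    toEnd (ofDer δ) b = δ b := rfl

/-- The inclusion of `ℂ{x, y}` into the ring of differential operators. -/
noncomputable def ofFunHom : ConvSeries →+* DiffOp where
  toFun := ofFun
  map_one' := ext_apply fun _ => by simp
  map_mul' _ _ := ext_apply fun _ => by simp [mul_assoc]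
  map_zero' := ext_apply fun _ => by simp
  map_add' _ _ := ext_apply fun _ => by simp [add_mul]

theorem ofFun_mul (a b : ConvSeries) : ofFun (a * b) = ofFun a * ofFun b := map_mul ofFunHom a b

theorem ofFun_add (a b : ConvSeries) : ofFun (a + b) = ofFun a + ofFun b := map_add ofFunHom a b

theorem ofFun_sub (a b : ConvSeries) : ofFun (a - b) = ofFun a - ofFun b := map_sub ofFunHom a b

theorem ofFun_one : ofFun 1 = 1 := map_one ofFunHom

theorem ofDer_add (δ ε : Derivation ℂ ConvSeries ConvSeries) :
    ofDer (δ + ε) = ofDer δ + ofDer ε :=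
  ext_apply fun _ => by simp

theorem ofDer_smul (a : ConvSeries) (δ : Derivation ℂ ConvSeries ConvSeries) :
    ofDer (a • δ) = ofFun a * ofDer δ :=
  ext_apply fun _ => by simp

theorem ofDer_mul_ofFun (δ : Derivation ℂ ConvSeries ConvSeries) (a : ConvSeries) :
    ofDer δ * ofFun a = ofFun a * ofDer δ + ofFun (δ a) :=
  ext_apply fun _ => by simp [mul_comm]

/-- Differential operators as a module over `ℂ{x, y}`, by multiplication on the left. -/
noncomputable instance : Module ConvSeries DiffOp := Module.compHom DiffOp ofFunHom

theorem smul_eq (a : ConvSeries) (P : DiffOp) : a • P = ofFun a * P := rfl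

/-- The partial derivatives as differential operators. -/
noncomputable def partialOp (i : Fin 2) : DiffOp := ofDer (pd i)

theorem commute_partialOp (i j : Fin 2) : Commute (partialOp i) (partialOp j) := by
  refine ext_apply fun a => ConvSeries.ext_coeff fun m => ?_
  rcases eq_or_ne i j with rfl | h
  · rfl
  · simp [partialOp, coeff_pderiv, h, h.symm, add_right_comm]
    ring

/-- The differential operator `∂_x ^ m 0 * ∂_y ^ m 1`. -/
noncomputable def partialPow (m : Fin 2 →₀ ℕ) : DiffOp := partialOp 0 ^ m 0 * partialOp 1 ^ m 1

theorem partialPow_zero : partialPow 0 = 1 := by simp [partialPow]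

theorem partialPow_add (m n : Fin 2 →₀ ℕ) :
    partialPow (m + n) = partialPow m * partialPow n := by
  have h : Commute (partialOp 1 ^ m 1) (partialOp 0 ^ n 0) :=
    (commute_partialOp 1 0).pow_pow _ _
  simp only [partialPow, Finsupp.add_apply, pow_add]
  rw [mul_assoc, ← mul_assoc (partialOp 0 ^ n 0), ← h.eq]
  simp only [mul_assoc]

theorem partialPow_single (i : Fin 2) : partialPow (single i 1) = partialOp i := by
  fin_cases i <;> simp [partialPow]

/-- The constant is `(n i + 1) ⋯ (n i + k)`; only its nonvanishing is used. -/
theorem coeff_partialOp_pow (i : Fin 2) (k : ℕ) (n : Fin 2 →₀ ℕ) : ∃ c : ℂ, c ≠ 0 ∧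
    ∀ a, MvPowerSeries.coeff n (toEnd (partialOp i ^ k) a).toSeries =
      c * MvPowerSeries.coeff (n + single i k) a.toSeries := by
  induction k generalizing n with
  | zero => exact ⟨1, one_ne_zero, by simp⟩
  | succ k ih =>
    obtain ⟨c, hc, h⟩ := ih (n + single i 1)
    refine ⟨c * (n i + 1), mul_ne_zero hc (Nat.cast_add_one_ne_zero _), fun a => ?_⟩
    rw [pow_succ', map_mul, Module.End.mul_apply]
    rw [partialOp, toEnd_ofDer, ConvSeries.toSeries_pd, coeff_pderiv, ← partialOp, h, add_assoc,
      ← Finsupp.single_add, add_comm 1 k]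
    ring

theorem coeff_partialPow (m n : Fin 2 →₀ ℕ) : ∃ c : ℂ, c ≠ 0 ∧
    ∀ a, MvPowerSeries.coeff n (toEnd (partialPow m) a).toSeries =
      c * MvPowerSeries.coeff (n + m) a.toSeries := by
  obtain ⟨c₀, hc₀, h₀⟩ := coeff_partialOp_pow 0 (m 0) n
  obtain ⟨c₁, hc₁, h₁⟩ := coeff_partialOp_pow 1 (m 1) (n + single 0 (m 0))
  refine ⟨c₀ * c₁, mul_ne_zero hc₀ hc₁, fun a => ?_⟩
  have hm : n + single 0 (m 0) + single 1 (m 1) = n + m := by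
    ext i; fin_cases i <;> simp
  rw [partialPow, map_mul, Module.End.mul_apply, h₀, h₁, hm, mul_assoc]

/-- The differential operator `∑ a_m ∂^m` with total symbol `∑ a_m ξ^m`. -/
noncomputable def ofSymbol : MvPolynomial (Fin 2) ConvSeries →ₗ[ConvSeries] DiffOp :=
  (MvPolynomial.basisMonomials (Fin 2) ConvSeries).constr ℕ partialPow

theorem ofSymbol_monomial (m : Fin 2 →₀ ℕ) (a : ConvSeries) :
    ofSymbol (MvPolynomial.monomial m a) = ofFun a * partialPow m := by
  have h : MvPolynomial.monomial m a = a • MvPolynomial.basisMonomials (Fin 2) ConvSeries m := by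
    rw [MvPolynomial.coe_basisMonomials, MvPolynomial.smul_monomial, smul_eq_mul, mul_one]
  rw [h, map_smul, ofSymbol, Module.Basis.constr_basis, smul_eq]

theorem ofSymbol_mul_X (p : MvPolynomial (Fin 2) ConvSeries) (i : Fin 2) :
    ofSymbol (p * MvPolynomial.X i) = ofSymbol p * partialOp i := by
  induction p using MvPolynomial.induction_on' with
  | monomial m a =>
    rw [MvPolynomial.X, MvPolynomial.monomial_mul, mul_one, ofSymbol_monomial, ofSymbol_monomial,
      partialPow_add, partialPow_single, mul_assoc]
  | add p q hp hq => rw [add_mul, map_add, map_add, add_mul, hp, hq]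

theorem ofSymbol_C_mul (a : ConvSeries) (p : MvPolynomial (Fin 2) ConvSeries) :
    ofSymbol (MvPolynomial.C a * p) = ofFun a * ofSymbol p := by
  rw [MvPolynomial.C_mul', map_smul, smul_eq]

/-- Evaluate at the monomial with exponent `m`, by induction on the degree: `∂^k` kills it if `k ≠
m` has degree at least that of `m`, `∂^m` sends it to a nonzero constant, and the coefficients of
lower degree already vanish. -/
theorem ofSymbol_injective : Function.Injective ofSymbol := by
  rw [injective_iff_map_eq_zero]
  intro p hp
  have key : ∀ N : ℕ, ∀ m : Fin 2 →₀ ℕ, m.degree = N → MvPolynomial.coeff m p = 0 := by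
    intro N
    induction N using Nat.strong_induction_on with
    | _ N ih =>
      rintro m rfl
      set h : ConvSeries := ConvSeries.mk _ (IsConvergentSeries.monomial m 1) with hh
      have h1 : ∀ k, k ≠ m → MvPolynomial.coeff k p * toEnd (partialPow k) h = 0 := by
        intro k hk
        by_cases hkm : k.degree < m.degree
        · rw [ih _ hkm k rfl, zero_mul]
        · convert mul_zero _
          refine ConvSeries.ext_coeff fun n => ?_
          obtain ⟨c, -, hc⟩ := coeff_partialPow k n
          rw [hc, hh, ConvSeries.toSeries_mk, coeff_monomial_ne, mul_zero, map_zero, map_zero]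
          intro hnk
          have hd := congrArg Finsupp.degree hnk
          rw [map_add] at hd
          have hn : n = 0 := by
            rw [← Finsupp.degree_eq_zero_iff]; omega
          exact hk (by rw [← hnk, hn, zero_add])
      have h2 : toEnd (partialPow m) h ≠ 0 := by
        intro h0
        obtain ⟨c, hc0, hc⟩ := coeff_partialPow m 0
        have := hc h
        rw [h0, hh, ConvSeries.toSeries_mk, zero_add, coeff_monomial_same] at this
        simp at this
        exact hc0 this.symm
      have h3 : toEnd (ofSymbol p) h = MvPolynomial.coeff m p * toEnd (partialPow m) h := by
        conv_lhs => rw [← MvPolynomial.support_sum_monomial_coeff p]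
        rw [map_sum, map_sum, LinearMap.sum_apply]
        simp only [ofSymbol_monomial, map_mul, Module.End.mul_apply, toEnd_ofFun]
        rw [Finset.sum_eq_single m (fun k _ hk => h1 k hk)]
        intro hm
        rw [MvPolynomial.notMem_support_iff.1 hm, zero_mul]
      rw [hp, map_zero, LinearMap.zero_apply] at h3
      exact (mul_eq_zero.1 h3.symm).resolve_right h2
  ext1 m
  rw [key _ m rfl, MvPolynomial.coeff_zero]

end DiffOp

/-! ### The order filtration and multiplication of symbols -/

/-- The polynomials all of whose monomials have degree less than `n`. -/
def degreeLT (n : ℕ) : Submodule ConvSeries (MvPolynomial (Fin 2) ConvSeries) where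
  carrier := {p | ∀ m : Fin 2 →₀ ℕ, n ≤ m.degree → MvPolynomial.coeff m p = 0}
  zero_mem' _ _ := MvPolynomial.coeff_zero _
  add_mem' hp hq m hm := by rw [MvPolynomial.coeff_add, hp m hm, hq m hm, add_zero]
  smul_mem' a p hp m hm := by rw [MvPolynomial.coeff_smul, hp m hm, smul_zero]

theorem monomial_mem_degreeLT {n : ℕ} {m : Fin 2 →₀ ℕ} (h : m.degree < n) (a : ConvSeries) :
    MvPolynomial.monomial m a ∈ degreeLT n := by
  intro k hk
  rw [MvPolynomial.coeff_monomial, if_neg]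
  rintro rfl
  omega

theorem degreeLT_mono {n k : ℕ} (h : n ≤ k) : degreeLT n ≤ degreeLT k :=
  fun _ hp m hm => hp m (h.trans hm)

theorem degreeLT_induction {n : ℕ} {motive : MvPolynomial (Fin 2) ConvSeries → Prop}
    (zero : motive 0) (add : ∀ p q, motive p → motive q → motive (p + q))
    (monomial : ∀ m : Fin 2 →₀ ℕ, m.degree < n → ∀ a, motive (MvPolynomial.monomial m a))
    {p : MvPolynomial (Fin 2) ConvSeries} (hp : p ∈ degreeLT n) : motive p := by
  rw [← MvPolynomial.support_sum_monomial_coeff p]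
  refine Finset.sum_induction _ motive add zero fun m hm => monomial m ?_ _
  by_contra h
  exact MvPolynomial.mem_support_iff.1 hm (hp m (not_lt.1 h))

theorem mem_degreeLT_of_totalDegree_lt {n : ℕ} {p : MvPolynomial (Fin 2) ConvSeries}
    (h : p.totalDegree < n) : p ∈ degreeLT n := fun m hm =>
  MvPolynomial.coeff_eq_zero_of_totalDegree_lt (by
    rw [← Finsupp.degree_apply]; omega)

theorem eq_zero_of_mem_degreeLT_zero {p : MvPolynomial (Fin 2) ConvSeries}
    (h : p ∈ degreeLT 0) : p = 0 := by
  ext1 m; rw [h m (Nat.zero_le _), MvPolynomial.coeff_zero]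

theorem exists_mem_degreeLT (p : MvPolynomial (Fin 2) ConvSeries) : ∃ n, p ∈ degreeLT n :=
  ⟨_, mem_degreeLT_of_totalDegree_lt (Nat.lt_succ_self _)⟩

namespace DiffOp

/-- The differential operators of order less than `n`. -/
noncomputable def orderLT (n : ℕ) : Submodule ConvSeries DiffOp := (degreeLT n).map ofSymbol

theorem ofSymbol_mem_orderLT {n : ℕ} {p : MvPolynomial (Fin 2) ConvSeries}
    (hp : p ∈ degreeLT n) : ofSymbol p ∈ orderLT n := Submodule.mem_map_of_mem hp

theorem orderLT_mono {n k : ℕ} (h : n ≤ k) : orderLT n ≤ orderLT k :=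
  Submodule.map_mono (degreeLT_mono h)

theorem ofFun_mul_mem_orderLT {n : ℕ} {P : DiffOp} (a : ConvSeries) (hP : P ∈ orderLT n) :
    ofFun a * P ∈ orderLT n := (orderLT n).smul_mem a hP

theorem partialPow_mem_orderLT {n : ℕ} {m : Fin 2 →₀ ℕ} (h : m.degree < n) :
    partialPow m ∈ orderLT n := by
  have := ofSymbol_mem_orderLT (monomial_mem_degreeLT h 1)
  rwa [ofSymbol_monomial, ofFun_one, one_mul] at this

theorem partialOp_mul_mem_orderLT {n : ℕ} {P : DiffOp} (i : Fin 2) (hP : P ∈ orderLT n) :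
    partialOp i * P ∈ orderLT (n + 1) := by
  obtain ⟨p, hp, rfl⟩ := hP
  refine degreeLT_induction (n := n)
    (motive := fun p => partialOp i * ofSymbol p ∈ orderLT (n + 1))
    ?_ (fun p q hp hq => ?_) (fun m hm a => ?_) hp
  · simp
  · rw [map_add, mul_add]; exact add_mem hp hq
  · rw [ofSymbol_monomial, ← mul_assoc, partialOp, ofDer_mul_ofFun, ← partialOp, add_mul, mul_assoc,
      ← partialPow_single, ← partialPow_add]
    refine add_mem (ofFun_mul_mem_orderLT _ (partialPow_mem_orderLT ?_))
      (ofFun_mul_mem_orderLT _ (partialPow_mem_orderLT (by omega)))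
    rw [map_add, degree_single]; omega

theorem mul_partialOp_mem_orderLT {n : ℕ} {P : DiffOp} (i : Fin 2) (hP : P ∈ orderLT n) :
    P * partialOp i ∈ orderLT (n + 1) := by
  obtain ⟨p, hp, rfl⟩ := hP
  refine degreeLT_induction (n := n)
    (motive := fun p => ofSymbol p * partialOp i ∈ orderLT (n + 1))
    ?_ (fun p q hp hq => ?_) (fun m hm a => ?_) hp
  · simp
  · rw [map_add, add_mul]; exact add_mem hp hq
  · rw [ofSymbol_monomial, mul_assoc, ← partialPow_single, ← partialPow_add]
    refine ofFun_mul_mem_orderLT _ (partialPow_mem_orderLT ?_)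
    rw [map_add, degree_single]; omega

/-- Peeling off one `∂_i` leaves `∂_i` times a shorter commutator, plus `(∂_i b) ∂^k`. -/
theorem partialPow_commutator_mem_orderLT (m : Fin 2 →₀ ℕ) (b : ConvSeries) :
    partialPow m * ofFun b - ofFun b * partialPow m ∈ orderLT m.degree := by
  induction hN : m.degree generalizing m with
  | zero =>
    rw [Finsupp.degree_eq_zero_iff] at hN
    simp [hN, partialPow_zero]
  | succ N ih =>
    have hm0 : m ≠ 0 := by rintro rfl; simp at hN
    obtain ⟨i, hi⟩ := Finsupp.ne_iff.1 hm0
    have hle : single i 1 ≤ m := Finsupp.single_le_iff.2 (Nat.one_le_iff_ne_zero.2 hi)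
    obtain ⟨k, rfl⟩ := exists_add_of_le hle
    have hk : k.degree = N := by
      rw [map_add, degree_single] at hN; omega
    rw [partialPow_add, partialPow_single]
    have h : partialOp i * partialPow k * ofFun b - ofFun b * (partialOp i * partialPow k) =
        partialOp i * (partialPow k * ofFun b - ofFun b * partialPow k) +
          ofFun (pd i b) * partialPow k := by
      have := ofDer_mul_ofFun (pd i) b
      rw [← partialOp] at this
      rw [mul_sub, ← mul_assoc (partialOp i) (ofFun b), this]
      noncomm_ring
    rw [h]
    exact add_mem (partialOp_mul_mem_orderLT i (ih k hk))
      (ofFun_mul_mem_orderLT _ (partialPow_mem_orderLT (by omega)))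

theorem ofSymbol_mul_ofFun_sub_mem {n : ℕ} {p : MvPolynomial (Fin 2) ConvSeries}
    (hp : p ∈ degreeLT (n + 1)) (b : ConvSeries) :
    ofSymbol p * ofFun b - ofSymbol (p * MvPolynomial.C b) ∈ orderLT n := by
  refine degreeLT_induction (n := n + 1)
    (motive := fun p =>
      ofSymbol p * ofFun b - ofSymbol (p * MvPolynomial.C b) ∈ orderLT n)
    ?_ (fun p q hp hq => ?_) (fun m hm a => ?_) hp
  · simp
  · have h : ofSymbol (p + q) * ofFun b - ofSymbol ((p + q) * MvPolynomial.C b) =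
        (ofSymbol p * ofFun b - ofSymbol (p * MvPolynomial.C b)) +
          (ofSymbol q * ofFun b - ofSymbol (q * MvPolynomial.C b)) := by
      simp only [add_mul, map_add]; abel
    rw [h]; exact add_mem hp hq
  · rw [mul_comm, ofSymbol_C_mul, ofSymbol_monomial]
    have h : ofFun a * partialPow m * ofFun b - ofFun b * (ofFun a * partialPow m) =
        ofFun a * (partialPow m * ofFun b - ofFun b * partialPow m) := by
      rw [← mul_assoc (ofFun b), ← ofFun_mul, mul_comm b a, ofFun_mul]; noncomm_ring
    rw [h]
    exact ofFun_mul_mem_orderLT _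
      (orderLT_mono (by omega) (partialPow_commutator_mem_orderLT m b))

theorem ofSymbol_mul_ofFun_mem {n : ℕ} {p : MvPolynomial (Fin 2) ConvSeries}
    (hp : p ∈ degreeLT n) (b : ConvSeries) : ofSymbol p * ofFun b ∈ orderLT n := by
  have h1 := ofSymbol_mem_orderLT ((degreeLT n).smul_mem b hp)
  cases n with
  | zero => simp [eq_zero_of_mem_degreeLT_zero hp]
  | succ n =>
    have h2 := orderLT_mono (Nat.le_succ n) (ofSymbol_mul_ofFun_sub_mem hp b)
    rw [← MvPolynomial.C_mul', mul_comm] at h1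
    simpa using add_mem h2 h1

theorem ofDer_eq (δ : Derivation ℂ ConvSeries ConvSeries) :
    ofDer δ = ofFun (δ (var 0)) * partialOp 0 + ofFun (δ (var 1)) * partialOp 1 := by
  conv_lhs => rw [ConvSeries.derivation_eq δ]
  rw [ofDer_add, ofDer_smul, ofDer_smul, partialOp, partialOp]

/-- Multiplication by a first order operator multiplies symbols, up to lower order terms. -/
theorem ofSymbol_mul_sub_mem {n : ℕ} {p : MvPolynomial (Fin 2) ConvSeries} (hp : p ∈ degreeLT n)
    (δ : Derivation ℂ ConvSeries ConvSeries) (a : ConvSeries) :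
    ofSymbol p * (ofDer δ + ofFun a) - ofSymbol (p * derSymbol δ) ∈ orderLT n := by
  have h1 := ofSymbol_mul_ofFun_mem hp a
  cases n with
  | zero => simp [eq_zero_of_mem_degreeLT_zero hp]
  | succ n =>
    have h2 : ∀ i b, ofSymbol p * (ofFun b * partialOp i) -
        ofSymbol (p * (MvPolynomial.C b * MvPolynomial.X i)) ∈ orderLT (n + 1) := by
      intro i b
      have := mul_partialOp_mem_orderLT i (ofSymbol_mul_ofFun_sub_mem hp b)
      rwa [sub_mul, ← ofSymbol_mul_X, mul_assoc, mul_assoc] at this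
    have h3 : ofSymbol p * (ofDer δ + ofFun a) - ofSymbol (p * derSymbol δ) =
        (ofSymbol p * (ofFun (δ (var 0)) * partialOp 0) -
          ofSymbol (p * (MvPolynomial.C (δ (var 0)) * MvPolynomial.X 0))) +
        (ofSymbol p * (ofFun (δ (var 1)) * partialOp 1) -
          ofSymbol (p * (MvPolynomial.C (δ (var 1)) * MvPolynomial.X 1))) +
        ofSymbol p * ofFun a := by
      rw [ofDer_eq, derSymbol, mul_add p, map_add]; noncomm_ring
    rw [h3]
    exact add_mem (add_mem (h2 _ _) (h2 _ _)) h1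

theorem mul_ofDer_add_ofFun_mem_range {P : DiffOp} (hP : P ∈ LinearMap.range ofSymbol)
    (δ : Derivation ℂ ConvSeries ConvSeries) (a : ConvSeries) :
    P * (ofDer δ + ofFun a) ∈ LinearMap.range ofSymbol := by
  obtain ⟨p, rfl⟩ := hP
  obtain ⟨n, hn⟩ := exists_mem_degreeLT p
  have h1 := LinearMap.map_le_range (ofSymbol_mul_sub_mem hn δ a)
  simpa using add_mem h1 (LinearMap.mem_range_self ofSymbol (p * derSymbol δ))

/-- The range contains 1 and is stable under right multiplication by the generators of `𝒟`, hence by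
all of `𝒟`. -/
theorem ofSymbol_surjective : Function.Surjective ofSymbol := by
  have key : ∀ (x : Module.End ℂ ConvSeries) (hx : x ∈ diffOps), ∀ P ∈ LinearMap.range ofSymbol,
      P * (show DiffOp from (⟨x, hx⟩ : diffOps)) ∈ LinearMap.range ofSymbol := by
    intro x hx
    refine Algebra.adjoin_induction (p := fun x hx => ∀ P ∈ LinearMap.range ofSymbol,
      P * (show DiffOp from (⟨x, hx⟩ : diffOps)) ∈ LinearMap.range ofSymbol) ?_ ?_ ?_ ?_ hx
    · rintro x (⟨a, rfl⟩ | ⟨δ, rfl⟩) P hP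
      · have := mul_ofDer_add_ofFun_mem_range hP 0 a
        have h0 : ofDer 0 = 0 := ext_apply fun _ => by simp
        rwa [h0, zero_add] at this
      · have := mul_ofDer_add_ofFun_mem_range hP δ 0
        have h0 : ofFun 0 = 0 := map_zero ofFunHom
        rwa [h0, add_zero] at this
    · intro c P hP
      have h : P * algebraMap ℂ DiffOp c ∈ LinearMap.range ofSymbol := by
        rw [← Algebra.commutes]
        have h' : algebraMap ℂ DiffOp c = ofFun (algebraMap ℂ ConvSeries c) :=
          ext_apply fun b => by
            rw [AlgHom.commutes, toEnd_ofFun, Module.algebraMap_end_apply, Algebra.smul_def]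
        rw [h']
        exact (LinearMap.range ofSymbol).smul_mem _ hP
      exact h
    · intro x y hx hy h1 h2 P hP
      have := add_mem (h1 P hP) (h2 P hP)
      rw [← mul_add] at this
      exact this
    · intro x y hx hy h1 h2 P hP
      have := h2 _ (h1 P hP)
      rw [mul_assoc] at this
      exact this
  intro P
  have h1 : (1 : DiffOp) ∈ LinearMap.range ofSymbol := by
    refine ⟨MvPolynomial.monomial 0 1, ?_⟩
    rw [ofSymbol_monomial, partialPow_zero, ofFun_one, one_mul]
  have := key P.val P.property 1 h1
  rw [one_mul] at this
  exact this

end DiffOp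

/-! ### Syzygies of first order operators -/

theorem mul_derSymbol_mem_degreeLT {n : ℕ} {p : MvPolynomial (Fin 2) ConvSeries}
    (hp : p ∈ degreeLT n) (δ : Derivation ℂ ConvSeries ConvSeries) :
    p * derSymbol δ ∈ degreeLT (n + 1) := by
  refine degreeLT_induction (n := n) (motive := fun p => p * derSymbol δ ∈ degreeLT (n + 1))
    ?_ (fun p q hp hq => ?_) (fun m hm a => ?_) hp
  · simp
  · rw [add_mul]; exact add_mem hp hq
  · have h : ∀ i (b : ConvSeries), MvPolynomial.monomial m a *
        (MvPolynomial.C b * MvPolynomial.X i) ∈ degreeLT (n + 1) := by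
      intro i b
      rw [MvPolynomial.C_mul_X_eq_monomial, MvPolynomial.monomial_mul]
      refine monomial_mem_degreeLT ?_ _
      rw [map_add, degree_single]; omega
    rw [derSymbol, mul_add]
    exact add_mem (h _ _) (h _ _)

theorem totalDegree_le_of_mem_degreeLT {n : ℕ} {p : MvPolynomial (Fin 2) ConvSeries}
    (hp : p ∈ degreeLT (n + 1)) : p.totalDegree ≤ n := by
  rw [MvPolynomial.totalDegree]
  refine Finset.sup_le fun m hm => ?_
  by_contra h
  refine MvPolynomial.mem_support_iff.1 hm (hp m ?_)
  rw [Finsupp.degree_apply]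
  exact not_le.1 h

theorem sub_homogeneousComponent_mem_degreeLT {n : ℕ} {p : MvPolynomial (Fin 2) ConvSeries}
    (hp : p ∈ degreeLT (n + 1)) : p - MvPolynomial.homogeneousComponent n p ∈ degreeLT n := by
  intro m hm
  rw [MvPolynomial.coeff_sub, MvPolynomial.coeff_homogeneousComponent]
  split_ifs with h
  · exact sub_self _
  · rw [hp m (by omega), sub_zero]

theorem eq_zero_of_isHomogeneous_of_mem_degreeLT {n : ℕ} {p : MvPolynomial (Fin 2) ConvSeries}
    (h : p.IsHomogeneous n) (hp : p ∈ degreeLT n) : p = 0 := by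
  ext1 m
  rw [MvPolynomial.coeff_zero]
  by_cases hm : m.degree = n
  · exact hp m hm.ge
  · exact h.coeff_eq_zero hm

namespace DiffOp

theorem mem_degreeLT_of_ofSymbol_mem {n : ℕ} {p : MvPolynomial (Fin 2) ConvSeries}
    (h : ofSymbol p ∈ orderLT n) : p ∈ degreeLT n := by
  obtain ⟨q, hq, he⟩ := h
  exact ofSymbol_injective he ▸ hq

/-- Over a domain, multiplying by `σ(δ) ≠ 0` raises the degree of the symbol by exactly one, so the
leading term cannot cancel. -/
theorem eq_zero_of_mul_ofDer_add_ofFun_eq_zero {P : DiffOp}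
    {δ : Derivation ℂ ConvSeries ConvSeries} (hδ : δ ≠ 0) {a : ConvSeries}
    (h : P * (ofDer δ + ofFun a) = 0) : P = 0 := by
  obtain ⟨p, rfl⟩ := ofSymbol_surjective P
  by_cases hp : p = 0
  · rw [hp, map_zero]
  exfalso
  have hσ : derSymbol δ ≠ 0 := fun h => hδ (derSymbol_eq_zero h)
  have h1 := ofSymbol_mul_sub_mem (mem_degreeLT_of_totalDegree_lt (Nat.lt_succ_self _)) (p := p) δ a
  rw [h, zero_sub, neg_mem_iff] at h1
  have h2 := totalDegree_le_of_mem_degreeLT (mem_degreeLT_of_ofSymbol_mem h1)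
  rw [MvPolynomial.totalDegree_mul_of_isDomain hp hσ,
    (isHomogeneous_derSymbol δ).totalDegree hσ] at h2
  omega

/-- The syzygies of two first order operators with coprime symbols are generated by any
first order syzygy lifting the Koszul syzygy of the symbols. -/
theorem exists_eq_mul_of_mul_add_mul_eq_zero {δ₁ δ₂ : Derivation ℂ ConvSeries ConvSeries}
    (hδ₁ : δ₁ ≠ 0) (hrel : IsRelPrime (derSymbol δ₁) (derSymbol δ₂)) {a₁ a₂ b₁ b₂ : ConvSeries}
    (hsyz : (ofDer δ₁ + ofFun b₁) * (ofDer δ₂ + ofFun a₂) =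
      (ofDer δ₂ + ofFun b₂) * (ofDer δ₁ + ofFun a₁))
    {P Q : DiffOp} (h : P * (ofDer δ₁ + ofFun a₁) + Q * (ofDer δ₂ + ofFun a₂) = 0) :
    ∃ S, P = -(S * (ofDer δ₂ + ofFun b₂)) ∧ Q = S * (ofDer δ₁ + ofFun b₁) := by
  have hσ : derSymbol δ₁ ≠ 0 := fun h => hδ₁ (derSymbol_eq_zero h)
  have key : ∀ n : ℕ, ∀ P ∈ orderLT n, ∀ Q ∈ orderLT n,
      P * (ofDer δ₁ + ofFun a₁) + Q * (ofDer δ₂ + ofFun a₂) = 0 →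
      ∃ S, P = -(S * (ofDer δ₂ + ofFun b₂)) ∧ Q = S * (ofDer δ₁ + ofFun b₁) := by
    intro n
    induction n with
    | zero =>
      rintro _ ⟨p, hp, rfl⟩ _ ⟨q, hq, rfl⟩ -
      exact ⟨0, by simp [eq_zero_of_mem_degreeLT_zero hp, eq_zero_of_mem_degreeLT_zero hq]⟩
    | succ n ih =>
      rintro _ ⟨p, hp, rfl⟩ _ ⟨q, hq, rfl⟩ h
      set p' := MvPolynomial.homogeneousComponent n p
      set q' := MvPolynomial.homogeneousComponent n q
      have hp' := sub_homogeneousComponent_mem_degreeLT hp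
      have hq' := sub_homogeneousComponent_mem_degreeLT hq
      -- The operators cancel exactly, so only the lower order error terms of the symbol products
      -- remain.
      have h1 : p * derSymbol δ₁ + q * derSymbol δ₂ ∈ degreeLT (n + 1) := by
        refine mem_degreeLT_of_ofSymbol_mem ?_
        have := add_mem (ofSymbol_mul_sub_mem hp δ₁ a₁) (ofSymbol_mul_sub_mem hq δ₂ a₂)
        rwa [sub_add_sub_comm, h, zero_sub, neg_mem_iff, ← map_add] at this
      have h2 : p' * derSymbol δ₁ + q' * derSymbol δ₂ = 0 := by
        refine eq_zero_of_isHomogeneous_of_mem_degreeLT (n := n + 1)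
          (((MvPolynomial.homogeneousComponent_isHomogeneous n p).mul
            (isHomogeneous_derSymbol δ₁)).add
            ((MvPolynomial.homogeneousComponent_isHomogeneous n q).mul
            (isHomogeneous_derSymbol δ₂))) ?_
        have := sub_mem h1 (add_mem (mul_derSymbol_mem_degreeLT hp' δ₁)
          (mul_derSymbol_mem_degreeLT hq' δ₂))
        convert this using 1
        ring
      -- Coprimality makes the syzygy of the leading forms a Koszul syzygy, with multiplier `r`.
      obtain ⟨r, hr⟩ : derSymbol δ₁ ∣ q' :=
        hrel.dvd_of_dvd_mul_left ⟨-p', by linear_combination h2⟩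
      have hpr : p' = -(r * derSymbol δ₂) :=
        mul_right_cancel₀ hσ (by linear_combination h2 - derSymbol δ₂ * hr)
      have hrn : r ∈ degreeLT n := by
        by_cases hr0 : r = 0
        · rw [hr0]; exact zero_mem _
        refine mem_degreeLT_of_totalDegree_lt ?_
        have hd := (MvPolynomial.homogeneousComponent_isHomogeneous n q).totalDegree_le
        change q'.totalDegree ≤ n at hd
        rw [hr, MvPolynomial.totalDegree_mul_of_isDomain hσ hr0,
          (isHomogeneous_derSymbol δ₁).totalDegree hσ] at hd
        omega
      -- Subtracting `ofSymbol r` times the given syzygy cancels both leading forms, so the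
      -- induction hypothesis applies.
      obtain ⟨S, hS₁, hS₂⟩ := ih (ofSymbol p + ofSymbol r * (ofDer δ₂ + ofFun b₂)) (by
          have := add_mem (ofSymbol_mem_orderLT hp') (ofSymbol_mul_sub_mem hrn δ₂ b₂)
          rw [map_sub] at this
          change ofSymbol p - ofSymbol p' + _ ∈ _ at this
          rw [hpr, map_neg] at this
          convert this using 1
          abel) (ofSymbol q - ofSymbol r * (ofDer δ₁ + ofFun b₁)) (by
          have := sub_mem (ofSymbol_mem_orderLT hq') (ofSymbol_mul_sub_mem hrn δ₁ b₁)
          rw [map_sub] at this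
          change ofSymbol q - ofSymbol q' - _ ∈ _ at this
          rw [hr, mul_comm (derSymbol δ₁)] at this
          convert this using 1
          abel) (by
          rw [add_mul, sub_mul, mul_assoc, mul_assoc, hsyz, ← h]
          abel)
      refine ⟨S + ofSymbol r, ?_, ?_⟩
      · rw [eq_sub_of_add_eq hS₁, add_mul]; abel
      · rw [sub_eq_iff_eq_add.1 hS₂, add_mul]
  obtain ⟨p, rfl⟩ := ofSymbol_surjective P
  obtain ⟨q, rfl⟩ := ofSymbol_surjective Q
  obtain ⟨n, hn⟩ := exists_mem_degreeLT p
  obtain ⟨k, hk⟩ := exists_mem_degreeLT q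
  exact key (max n k) _ (ofSymbol_mem_orderLT (degreeLT_mono (le_max_left _ _) hn)) _
    (ofSymbol_mem_orderLT (degreeLT_mono (le_max_right _ _) hk)) h

/-- The syzygy between two logarithmic operators given by their commutator. -/
theorem ofDer_add_mul_ofDer_add {δ₁ δ₂ : Derivation ℂ ConvSeries ConvSeries}
    {f a₁ a₂ α₁ α₂ : ConvSeries} (hf : f ≠ 0) (ha₁ : δ₁ f = a₁ * f) (ha₂ : δ₂ f = a₂ * f)
    (hα : ⁅δ₁, δ₂⁆ = α₁ • δ₁ + α₂ • δ₂) :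
    (ofDer δ₁ + ofFun (a₁ - α₂)) * (ofDer δ₂ + ofFun a₂) =
      (ofDer δ₂ + ofFun (a₂ + α₁)) * (ofDer δ₁ + ofFun a₁) := by
  -- Both sides of the bracket relation are applied to `f`, which is then cancelled.
  have h1 : δ₁ a₂ - δ₂ a₁ = α₁ * a₁ + α₂ * a₂ := by
    have h := congrArg (fun δ : Derivation ℂ ConvSeries ConvSeries => δ f) hα
    simp only [Derivation.commutator_apply, ha₁, ha₂, Derivation.leibniz, Derivation.add_apply,
      Derivation.smul_apply, smul_eq_mul] at h
    exact mul_right_cancel₀ hf (by linear_combination h)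
  refine ext_apply fun u => ?_
  have h2 := congrArg (fun δ : Derivation ℂ ConvSeries ConvSeries => δ u) hα
  simp only [Derivation.commutator_apply, Derivation.add_apply, Derivation.smul_apply,
    smul_eq_mul] at h2
  simp only [map_mul, map_add, Module.End.mul_apply, LinearMap.add_apply, toEnd_ofDer, toEnd_ofFun,
    Derivation.leibniz, smul_eq_mul]
  linear_combination h2 + u * h1

end DiffOp

/-! ### Exactness of the resolution -/

theorem range_columnMap_eq_tildeILog {f : ConvSeries}
    (hf : f ≠ 0) {δ₁ δ₂ : Derivation ℂ ConvSeries ConvSeries} {a₁ a₂ : ConvSeries}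
    (hspan : ∀ δ ∈ derLog f, ∃ c₁ c₂ : ConvSeries, δ = c₁ • δ₁ + c₂ • δ₂)
    (ha₁ : δ₁ f = a₁ * f) (ha₂ : δ₂ f = a₂ * f) :
    LinearMap.range (columnMap (DiffOp.ofDer δ₁ + DiffOp.ofFun a₁)
      (DiffOp.ofDer δ₂ + DiffOp.ofFun a₂)) = tildeILog f := by
  apply le_antisymm
  · rintro _ ⟨P, rfl⟩
    rw [columnMap_apply]
    exact add_mem
      ((tildeILog f).smul_mem (P 0) (Submodule.subset_span ⟨δ₁, a₁, ha₁, rfl⟩))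
      ((tildeILog f).smul_mem (P 1) (Submodule.subset_span ⟨δ₂, a₂, ha₂, rfl⟩))
  · refine Submodule.span_le.2 ?_
    rintro _ ⟨δ, a, ha, rfl⟩
    obtain ⟨c₁, c₂, rfl⟩ := hspan δ (mem_derLog_iff.2 ⟨a, ha⟩)
    refine ⟨![DiffOp.ofFun c₁, DiffOp.ofFun c₂], ?_⟩
    -- The multiplier `a` is determined by `δ` because `f ≠ 0`, so `δ + a` is the same
    -- `𝒪`-combination of the two operators as `δ` is of `δ₁, δ₂`.
    have h : a = c₁ * a₁ + c₂ * a₂ := by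
      refine mul_right_cancel₀ hf ?_
      rw [← ha, Derivation.add_apply, Derivation.smul_apply, Derivation.smul_apply, ha₁, ha₂,
        smul_eq_mul, smul_eq_mul]
      ring
    rw [columnMap_apply, h, DiffOp.ofDer_add, DiffOp.ofDer_smul, DiffOp.ofDer_smul,
      DiffOp.ofFun_add, DiffOp.ofFun_mul, DiffOp.ofFun_mul]
    simp only [Matrix.cons_val_zero, Matrix.cons_val_one]
    noncomm_ring

end

theorem mainTheorem5 (f : ConvSeries) (hred : Squarefree f)
    (hf0 : MvPowerSeries.constantCoeff f.toSeries = 0)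
    (B : Module.Basis (Fin 2) ConvSeries (derLog f))
    (δ₁ δ₂ : Derivation ℂ ConvSeries ConvSeries)
    (hδ₁ : δ₁ = (B 0 : Derivation ℂ ConvSeries ConvSeries))
    (hδ₂ : δ₂ = (B 1 : Derivation ℂ ConvSeries ConvSeries))
    (a₁ a₂ α₁ α₂ : ConvSeries)
    (ha₁ : δ₁ f = a₁ * f) (ha₂ : δ₂ f = a₂ * f)
    (hα : ⁅δ₁, δ₂⁆ = α₁ • δ₁ + α₂ • δ₂) :
    let φ₂ : DiffOp →ₗ[DiffOp] (Fin 2 → DiffOp) :=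
      rowMap (-DiffOp.ofDer δ₂ - DiffOp.ofFun a₂ - DiffOp.ofFun α₁)
        (DiffOp.ofDer δ₁ + DiffOp.ofFun a₁ - DiffOp.ofFun α₂)
    let φ₁ : (Fin 2 → DiffOp) →ₗ[DiffOp] DiffOp :=
      columnMap (DiffOp.ofDer δ₁ + DiffOp.ofFun a₁) (DiffOp.ofDer δ₂ + DiffOp.ofFun a₂)
    let π : DiffOp →ₗ[DiffOp] TildeMLog f := (tildeILog f).mkQ
    Module.Free DiffOp DiffOp ∧ Module.Free DiffOp (Fin 2 → DiffOp) ∧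
      Function.Injective φ₂ ∧ Function.Exact φ₂ φ₁ ∧ Function.Exact φ₁ π ∧
      Function.Surjective π := by
  intro φ₂ φ₁ π
  have hf : f ≠ 0 := hred.ne_zero
  have hspan : ∀ δ ∈ derLog f, ∃ c₁ c₂ : ConvSeries, δ = c₁ • δ₁ + c₂ • δ₂ := by
    intro δ hδ
    have h := congrArg Subtype.val (B.sum_repr ⟨δ, hδ⟩)
    rw [Fin.sum_univ_two] at h
    exact ⟨_, _, by rw [hδ₁, hδ₂]; exact h.symm⟩
  have hind : ∀ c₁ c₂ : ConvSeries, c₁ • δ₁ + c₂ • δ₂ = 0 → c₁ = 0 ∧ c₂ = 0 := by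
    intro c₁ c₂ h
    have hB := Fintype.linearIndependent_iff.1 B.linearIndependent ![c₁, c₂] (by
      rw [Fin.sum_univ_two]
      refine Subtype.ext ?_
      rw [hδ₁, hδ₂] at h
      exact h)
    exact ⟨hB 0, hB 1⟩
  have hne : δ₁ ≠ 0 := fun h => one_ne_zero (hind 1 0 (by simp [h])).1
  have hsyz := DiffOp.ofDer_add_mul_ofDer_add hf ha₁ ha₂ hα
  have hu : -DiffOp.ofDer δ₂ - DiffOp.ofFun a₂ - DiffOp.ofFun α₁ =
      -(DiffOp.ofDer δ₂ + DiffOp.ofFun (a₂ + α₁)) := by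
    rw [DiffOp.ofFun_add]; abel
  have hv : DiffOp.ofDer δ₁ + DiffOp.ofFun a₁ - DiffOp.ofFun α₂ =
      DiffOp.ofDer δ₁ + DiffOp.ofFun (a₁ - α₂) := by
    rw [DiffOp.ofFun_sub]; abel
  refine ⟨inferInstance, inferInstance, ?_, ?_, ?_, Submodule.mkQ_surjective _⟩
  · rw [injective_iff_map_eq_zero]
    intro P hP
    -- The second component, `P` times an operator with nonzero symbol, already determines `P`.
    have h := congrFun hP 1
    simp only [φ₂, rowMap_apply, hv] at h
    exact DiffOp.eq_zero_of_mul_ofDer_add_ofFun_eq_zero hne h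
  · intro P
    simp only [φ₁, φ₂, columnMap_apply, Set.mem_range, rowMap_apply, hu, hv]
    constructor
    · intro h
      obtain ⟨S, h1, h2⟩ := DiffOp.exists_eq_mul_of_mul_add_mul_eq_zero hne
        (isRelPrime_derSymbol hred hspan hind) hsyz h
      refine ⟨S, ?_⟩
      ext i
      fin_cases i
      · exact (mul_neg _ _).trans h1.symm
      · exact h2.symm
    · rintro ⟨S, rfl⟩
      simp only [Matrix.cons_val_zero, Matrix.cons_val_one]
      rw [mul_assoc, mul_assoc, hsyz]
      noncomm_ring
  · rw [LinearMap.exact_iff, Submodule.ker_mkQ]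
    exact (range_columnMap_eq_tildeILog hf hspan ha₁ ha₂).symm
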